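/- Let $\alpha\in(0,1)$, let $(X,Y)$ be a random pair in $\mathbb R^p\times\mathbb R$, $p\ge 1$, and let $(X_1,Y_1),\dots,(X_n,Y_n)$ be i.i.d. copies of it. Suppose that for some $\beta^*,\theta^*\in\mathbb R^p$, almost surely, $Q_\alpha(Y\mid X)=X^{\mathsf T}\beta^*$ and $\mathrm{ES}_\alpha(Y\mid X)=\mathbb E\{Y\mid Y\le Q_\alpha(Y\mid X),X\}=X^{\mathsf T}\theta^*$, where $Q_\alpha(Y\mid X)$ is the conditional $\alpha$-quantile of $Y$ given $X$. Put $\Sigma=\mathbb E(XX^{\mathsf T})$, $W=\Sigma^{-1/2}X$, $W_i=\Sigma^{-1/2}X_i$, $\|u\|_\Sigma=\|\Sigma^{1/2}u\|_2$, $\varepsilon=Y-X^{\mathsf T}\beta^*$, $\varepsilon_-=\min(\varepsilon,0)$, let $\mathbb E_X,\mathrm{var}_X$ denote conditional expectation and variance given $X$, and assume: 1. Almost surely, the conditional CDF $F_{\varepsilon|X}$ of $\varepsilon$ given $X$ is continuously differentiable with $|F_{\varepsilon|X}(t)-F_{\varepsilon|X}(0)|\le\bar f|t|$ for all $t\in\mathbb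 R$, and $\mathrm{var}_X(\varepsilon_-)\le\bar\sigma^2$, where $\bar\sigma>0$. 2. $\Sigma$ exists and is positive definite, and $\mathbb P(|u^{\mathsf T}W|\ge\upsilon_1t)\le2e^{-t^2/2}$ for all $t\ge0$ and all unit vectors $u$, where $\upsilon_1\ge1$. 3. Almost surely, the conditional density $f_{\varepsilon|X}$ of $\varepsilon$ given $X$ exists, is continuous on its support, and satisfies $f_{\varepsilon|X}(0)\ge\underline f$ and $|f_{\varepsilon|X}(t)-f_{\varepsilon|X}(0)|\le l_0|t|$ for all $t\in\mathbb R$, where $\underline f,l_0>0$. 4. Almost surely, $\mathbb E_X(|\varepsilon_-|^3)\le\alpha_3$ and $\max_{1\le i\le n}\|W_i\|_2\le C_0\sqrt p$, where $\alpha_3,C_0>0$. For $\beta,\theta\in\mathbb R^p$ let $\omega_i(\beta,\theta)=(Y_i-X_i^{\mathsf T}\beta)\mathbf 1(Y_i\le X_i^{\mathsf T}\beta)+\alpha X_i^{\mathsf T}(\beta-\theta)$, and define $\omega(\beta,\theta)$ in the same way from $(X,Y)$. Let $\Omega=\mathbb E\{\omega(\beta^*,\theta^*)^2XX^{\mathsf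 T}\}$ and, for $\gamma>0$, $$\hat\Omega_\gamma(\beta,\theta)=\frac1n\sum_{i=1}^n\psi_\gamma^2(\omega_i(\beta,\theta))X_iX_i^{\mathsf T},\qquad \psi_\gamma(t)=\mathrm{sign}(t)\min(|t|,\gamma).$$ For $\tau>0$ let $\hat\beta$ be any minimizer over $\beta$ of $\frac1n\sum_i\rho_\alpha(Y_i-X_i^{\mathsf T}\beta)$, where $\rho_\alpha(u)=\{\alpha-\mathbf 1(u<0)\}u$, and let $\hat\theta_\tau$ be any minimizer over $\theta$ of $\frac1n\sum_i\ell_\tau(S_i(\hat\beta,\theta))$, where $S_i(\beta,\theta)=\alpha X_i^{\mathsf T}\theta-\mathbf 1(Y_i\le X_i^{\mathsf T}\beta)Y_i+\{\mathbf 1(Y_i\le X_i^{\mathsf T}\beta)-\alpha\}X_i^{\mathsf T}\beta$ and $\ell_\tau$ is the Huber loss ($u^2/2$ if $|u|\le\tau$, and $\tau|u|-\tau^2/2$ otherwise). The truncated sandwich estimator is $\hat\Omega_\gamma=\hat\Omega_\gamma(\hat\beta,\hat\theta_\tau)$. For $r_0,r_1>0$ put $\bar r=r_0+r_1$ and $$\Theta(r_0,r_1)=\{(\beta,\theta):\|\beta-\beta^*\|_\Sigma\le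 r_0,\ \alpha\|\theta-\theta^*\|_\Sigma\le r_1\}.$$ **Theorem.** There are constants $C,C'>0$ depending only on $\upsilon_1$ and $C_0$ such that, whenever $n\ge C'(p+\log n)$, for all $r_0,r_1,\gamma>0$ there is an event of probability at least $1-2/n$ on which, for every $\tau>0$ and all such estimators, $(\hat\beta,\hat\theta_\tau)\in\Theta(r_0,r_1)$ implies $$\|\Sigma^{-1/2}(\hat\Omega_\gamma-\Omega)\Sigma^{-1/2}\|_2\le C\Big[\max\{\alpha_3^{1/2},(\sqrt p\,\bar r)^{3/2}\}\sqrt{\frac{\gamma p\log n}{n}}+\frac{\gamma^2p\log n}{n}+\frac{\alpha_3}{\gamma}+(\bar\sigma+\bar r)\bar r\Big].$$ Moreover, on the same event the bound holds simultaneously for all $(\beta,\theta)\in\Theta(r_0,r_1)$ with $\hat\Omega_\gamma(\beta,\theta)$ in place of $\hat\Omega_\gamma$. -/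

import Mathlib

open MeasureTheory ProbabilityTheory
open scoped MatrixOrder RealInnerProductSpace

noncomputable section

namespace ESReg

/-- Covariate (and coefficient) space `ℝ^p` with the Euclidean norm. -/
abbrev Vec (p : ℕ) : Type := EuclideanSpace ℝ (Fin p)

/-! ### Linear algebra -/

/-- Spectral norm `‖M‖₂` of a square real matrix. -/
def specNorm {p : ℕ} (M : Matrix (Fin p) (Fin p) ℝ) : ℝ :=
  ‖Matrix.toEuclideanCLM (n := Fin p) (𝕜 := ℝ) M‖

/-- The rank-one matrix `x xᵀ`. -/
def outer {p : ℕ} (x : Vec p) : Matrix (Fin p) (Fin p) ℝ :=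
  Matrix.of fun j k => x j * x k

/-- Symmetric positive semidefinite square root `S^{1/2}` (used for positive definite `S`). -/
def sqrtM {p : ℕ} (S : Matrix (Fin p) (Fin p) ℝ) : Matrix (Fin p) (Fin p) ℝ :=
  CFC.sqrt S

/-- `S^{-1/2}` (used for positive definite `S`). -/
def invSqrtM {p : ℕ} (S : Matrix (Fin p) (Fin p) ℝ) : Matrix (Fin p) (Fin p) ℝ :=
  (sqrtM S)⁻¹

/-- The norm `‖u‖_S = ‖S^{1/2} u‖₂`. -/
def normS {p : ℕ} (S : Matrix (Fin p) (Fin p) ℝ) (u : Vec p) : ℝ :=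
  ‖Matrix.toEuclideanCLM (n := Fin p) (𝕜 := ℝ) (sqrtM S) u‖

/-- Standardized covariate `W = S^{-1/2} x`. -/
def standardize {p : ℕ} (S : Matrix (Fin p) (Fin p) ℝ) (x : Vec p) : Vec p :=
  Matrix.toEuclideanCLM (n := Fin p) (𝕜 := ℝ) (invSqrtM S) x

/-! ### Loss functions and residuals -/

/-- Check function `ρ_α(u) = {α - 1(u < 0)} u`. -/
def checkLoss (α u : ℝ) : ℝ := (α - if u < 0 then 1 else 0) * u

/-- Huber loss `ℓ_τ`. -/
def huberLoss (τ u : ℝ) : ℝ := if |u| ≤ τ then u ^ 2 / 2 else τ * |u| - τ ^ 2 / 2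

/-- Huber score `ψ_τ(t) = sign(t) min(|t|, τ)`. -/
def huberScore (τ t : ℝ) : ℝ := Real.sign t * min |t| τ

/-- The orthogonal score
`S(β, θ; y, x) = α xᵀθ - 1(y ≤ xᵀβ) y + {1(y ≤ xᵀβ) - α} xᵀβ`. -/
def score {p : ℕ} (α : ℝ) (β θ : Vec p) (x : Vec p) (y : ℝ) : ℝ :=
  α * ⟪x, θ⟫ - (if y ≤ ⟪x, β⟫ then 1 else 0) * y
    + ((if y ≤ ⟪x, β⟫ then 1 else 0) - α) * ⟪x, β⟫

/-- The expected-shortfall residual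
`ω(β, θ) = (y - xᵀβ) 1(y - xᵀβ ≤ 0) + α xᵀ(β - θ)`. -/
def esResid {p : ℕ} (α : ℝ) (β θ : Vec p) (x : Vec p) (y : ℝ) : ℝ :=
  (y - ⟪x, β⟫) * (if y - ⟪x, β⟫ ≤ 0 then 1 else 0) + α * ⟪x, β - θ⟫

/-! ### Population quantities

The data-generating distribution is a probability measure `P` on `ℝ^p × ℝ`, the joint law of a
generic pair `(X, Y)`; `P.fst` is the law of `X` and `P.condKernel x` is the regular conditional
law of `Y` given `X = x`. -/

/-- `Σ = E(X Xᵀ)`. -/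
def covX {p : ℕ} (P : Measure (Vec p × ℝ)) : Matrix (Fin p) (Fin p) ℝ :=
  Matrix.of fun j k => ∫ x, x j * x k ∂P.fst

/-- `Ω = E(ω² X Xᵀ)`, where `ω = ω(β, θ)`. -/
def covScore {p : ℕ} (P : Measure (Vec p × ℝ)) (α : ℝ) (β θ : Vec p) :
    Matrix (Fin p) (Fin p) ℝ :=
  Matrix.of fun j k => ∫ z, (esResid α β θ z.1 z.2) ^ 2 * (z.1 j * z.1 k) ∂P

/-- Conditional law of `ε = Y - Xᵀβ` given `X = x`. -/
def condErr {p : ℕ} (P : Measure (Vec p × ℝ)) [IsFiniteMeasure P] (β : Vec p) (x : Vec p) :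
    Measure ℝ :=
  (P.condKernel x).map fun y => y - ⟪x, β⟫

/-- The `α`-quantile `inf {y : F(y) ≥ α}` of a probability measure on `ℝ`. -/
def quantile (α : ℝ) (ν : Measure ℝ) : ℝ := sInf {y | α ≤ cdf ν y}

/-- The `α`-expected shortfall `E(Y | Y ≤ Q_α(Y))` of a probability measure on `ℝ`. -/
def expShortfall (α : ℝ) (ν : Measure ℝ) : ℝ :=
  ∫ y, y ∂(cond ν (Set.Iic (quantile α ν)))

/-- The joint regression model: `Q_α(Y | X) = Xᵀβ*` and `ES_α(Y | X) = Xᵀθ*` almost surely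
(with a well-defined conditional expected shortfall). -/
def JointModel {p : ℕ} (P : Measure (Vec p × ℝ)) [IsFiniteMeasure P] (α : ℝ)
    (βstar θstar : Vec p) : Prop :=
  ∀ᵐ x ∂P.fst,
    quantile α (P.condKernel x) = ⟪x, βstar⟫ ∧
    IntegrableOn (fun y : ℝ => y) (Set.Iic (quantile α (P.condKernel x))) (P.condKernel x) ∧
    expShortfall α (P.condKernel x) = ⟪x, θstar⟫

/-- Regularity of the conditional error law: the conditional CDF is continuously differentiable
with `|F(t) - F(0)| ≤ fbar |t|`, and `var_X(ε₋) ≤ σ²` with `ε₋ = ε ∧ 0`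
(`evariance` is infinite when the second moment is infinite). -/
def CondDistribution {p : ℕ} (P : Measure (Vec p × ℝ)) [IsFiniteMeasure P] (βstar : Vec p)
    (fbar σbar : ℝ) : Prop :=
  ∀ᵐ x ∂P.fst,
    ContDiff ℝ 1 (fun t : ℝ => cdf (condErr P βstar x) t) ∧
    (∀ t : ℝ, |cdf (condErr P βstar x) t - cdf (condErr P βstar x) 0| ≤ fbar * |t|) ∧
    evariance (fun e : ℝ => min e 0) (condErr P βstar x) ≤ ENNReal.ofReal (σbar ^ 2)

/-- Sub-Gaussian covariates: `Σ` exists and is positive definite, and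
`P(|uᵀW| ≥ υ t) ≤ 2 exp(-t²/2)` for all unit vectors `u` and `t ≥ 0`, where `W = Σ^{-1/2} X`. -/
def CondCovariate {p : ℕ} (P : Measure (Vec p × ℝ)) (υ : ℝ) : Prop :=
  MemLp (fun x : Vec p => x) 2 P.fst ∧
  (covX P).PosDef ∧
  ∀ u : Vec p, ‖u‖ = 1 → ∀ t : ℝ, 0 ≤ t →
    P.fst.real {x | υ * t ≤ |⟪u, standardize (covX P) x⟫|} ≤ 2 * Real.exp (-t ^ 2 / 2)

/-- The conditional density of `ε` given `X` exists, is continuous on its support, is at least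
`flow` at `0`, and satisfies `|f(t) - f(0)| ≤ l₀ |t|` for all `t`, almost surely. -/
def CondDensity {p : ℕ} (P : Measure (Vec p × ℝ)) [IsFiniteMeasure P] (βstar : Vec p)
    (flow l₀ : ℝ) : Prop :=
  ∀ᵐ x ∂P.fst, ∃ f : ℝ → ℝ,
    Measurable f ∧ (∀ t, 0 ≤ f t) ∧
    condErr P βstar x = volume.withDensity (fun t => ENNReal.ofReal (f t)) ∧
    ContinuousOn f (Function.support f) ∧
    flow ≤ f 0 ∧ ∀ t : ℝ, |f t - f 0| ≤ l₀ * |t|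

/-- `E_X(|ε₋|³) ≤ α₃` almost surely over `X`. -/
def ThirdMoment {p : ℕ} (P : Measure (Vec p × ℝ)) [IsFiniteMeasure P] (βstar : Vec p)
    (α₃ : ℝ) : Prop :=
  ∀ᵐ x ∂P.fst,
    ∫⁻ e, ENNReal.ofReal (|min e 0| ^ 3) ∂(condErr P βstar x) ≤ ENNReal.ofReal α₃

/-- The local set `Θ(r₀, r₁)` of pairs `(β, θ)` with `‖β - β*‖_Σ ≤ r₀`, `α ‖θ - θ*‖_Σ ≤ r₁`. -/
def localSet {p : ℕ} (P : Measure (Vec p × ℝ)) (α : ℝ) (βstar θstar : Vec p) (r₀ r₁ : ℝ) :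
    Set (Vec p × Vec p) :=
  {b | normS (covX P) (b.1 - βstar) ≤ r₀ ∧ α * normS (covX P) (b.2 - θstar) ≤ r₁}

/-! ### Estimators, as functions of the realized data `x : Fin n → ℝ^p`, `y : Fin n → ℝ` -/

/-- `β` is a quantile regression estimator: it minimizes `(1/n) ∑ ρ_α(yᵢ - xᵢᵀβ)`. -/
def IsQREstimator {n p : ℕ} (α : ℝ) (x : Fin n → Vec p) (y : Fin n → ℝ) (β : Vec p) : Prop :=
  IsMinOn (fun b : Vec p => (1 / (n : ℝ)) * ∑ i, checkLoss α (y i - ⟪x i, b⟫)) Set.univ β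

/-- `θ` is a Huberized expected-shortfall estimator with plugged-in `β`: it minimizes
`(1/n) ∑ ℓ_τ(Sᵢ(β, θ))` over `θ`. -/
def IsHuberESEstimator {n p : ℕ} (α τ : ℝ) (x : Fin n → Vec p) (y : Fin n → ℝ)
    (β θ : Vec p) : Prop :=
  IsMinOn (fun t : Vec p => (1 / (n : ℝ)) * ∑ i, huberLoss τ (score α β t (x i) (y i)))
    Set.univ θ

/-- Truncated estimator `(1/n) ∑ ψ_γ²(ωᵢ(β, θ)) xᵢ xᵢᵀ`; with `(β, θ)` the two estimators above
it is the truncated sandwich estimator built from the fitted residuals. -/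
def truncCov {n p : ℕ} (α γ : ℝ) (x : Fin n → Vec p) (y : Fin n → ℝ) (β θ : Vec p) :
    Matrix (Fin p) (Fin p) ℝ :=
  (1 / (n : ℝ)) • ∑ i, (huberScore γ (esResid α β θ (x i) (y i))) ^ 2 • outer (x i)

/-- The error `‖Σ^{-1/2} (Ωhat - Ω) Σ^{-1/2}‖₂` of the truncated estimator at `(β, θ)`. -/
def covError {n p : ℕ} (P : Measure (Vec p × ℝ)) (α : ℝ) (βstar θstar : Vec p) (γ : ℝ)
    (x : Fin n → Vec p) (y : Fin n → ℝ) (β θ : Vec p) : ℝ :=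
  specNorm (invSqrtM (covX P) * (truncCov α γ x y β θ - covScore P α βstar θstar)
    * invSqrtM (covX P))

/-- The rate
`max{α₃^{1/2}, (√p r)^{3/2}} √(γ p log n / n) + γ² p log n / n + α₃ / γ + (σ + r) r`. -/
def rate (n p : ℕ) (α₃ γ σbar r : ℝ) : ℝ :=
  max (Real.sqrt α₃) ((Real.sqrt p * r) ^ (3 / 2 : ℝ))
      * Real.sqrt (γ * (p * Real.log n / n))
    + γ ^ 2 * (p * Real.log n / n) + α₃ / γ + (σbar + r) * r

end ESReg

end

namespace ESReg

/-! ### Scalar inequalities -/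

/-! The error matrix is symmetric, so its norm is controlled by the quadratic forms in unit-ball
directions `u`. On the local set, with r = r₀ + r₁, write β = β* + Σ^{-1/2}(r b) and θ = θ* +
Σ^{-1/2}((r/α) t) with `b`, `t` in the unit ball. What remains is a scalar empirical mean of ψ_γ²(ω)
(uᵀW)², to be bounded uniformly over the triple (u, b, t).

Mean at a fixed triple: since E_X ε₋ = α(ES − q), the residual at the true parameters is ε₋ − E_X
ε₋. Its conditional second moment is therefore at most σ² and its third at most 8α₃
(`condKernel_esResid_moments`). Truncation then costs α₃/γ, and moving the parameters costs rσ + r²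
(`integral_truncated_sub_le`).

Fluctuation at a fixed triple: ψ_γ⁴ ≤ γ|ω|³ gives a variance proxy of order γ(α₃ + r³) from third
moments alone, while ψ_γ² ≤ γ² and the sub-Gaussianity of uᵀW give exponential moments at scale 1/γ²
(`integral_truncated_sq_mul_exp_le`). `bernstein_mean` needs exactly these two inputs.

Uniformity: a grid of mesh n⁻⁴ replaces each of u, b, t, and a union bound at level 16 p log n pays
for the three grids (`card_mul_exp_le`). Replacing (b, t) by grid points is a Lipschitz
perturbation, negligible because ‖W_i‖ ≤ C₀√p (`quadratic_form_lipschitz`); replacing u is absorbed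
into the operator norm (`opNorm_le_two_mul_of_net`). `exists_uniform_event` assembles these, and the
estimators are one particular point of the local set. -/

lemma exp_le_one_add_add_sq_mul_exp_abs (y : ℝ) :
    Real.exp y ≤ 1 + y + y ^ 2 * Real.exp |y| := by
  have h := Complex.norm_exp_sub_sum_le_norm_mul_exp (y : ℂ) 2
  have e : Complex.exp (y : ℂ) - ∑ m ∈ Finset.range 2, (y : ℂ) ^ m / (m.factorial : ℂ)
      = ((Real.exp y - (1 + y) : ℝ) : ℂ) := by
    simp [Finset.sum_range_succ]
  rw [e, Complex.norm_real, Complex.norm_real, Real.norm_eq_abs, Real.norm_eq_abs, sq_abs] at h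
  linarith [le_abs_self (Real.exp y - (1 + y))]

/-- Rounding is towards zero, so that no coordinate grows and the rounded vector stays in the unit
ball. -/
lemma exists_int_div_near (M : ℕ) (hM : 0 < M) (v : ℝ) (hv : |v| ≤ 1) :
    ∃ k ∈ Finset.Icc (-(M : ℤ)) M, |(k : ℝ) / M| ≤ |v| ∧ |v - k / M| ≤ 1 / M := by
  have hM' : (0 : ℝ) < M := by exact_mod_cast hM
  wlog h0 : 0 ≤ v generalizing v
  · obtain ⟨k, hk, h1, h2⟩ := this (-v) (by simpa using hv) (by linarith)
    refine ⟨-k, by simp only [Finset.mem_Icc] at *; omega, ?_, ?_⟩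
    · push_cast; rw [neg_div, abs_neg]; simpa using h1
    · push_cast; rw [← abs_neg]; convert h2 using 2; ring
  have h1 := Int.floor_le (M * v)
  have h2 := Int.lt_floor_add_one (M * v)
  have h3 : 0 ≤ ⌊M * v⌋ := Int.floor_nonneg.2 (by positivity)
  have h3' : (0 : ℝ) ≤ ⌊M * v⌋ := by exact_mod_cast h3
  rw [abs_of_nonneg h0] at hv
  have h5 : (⌊M * v⌋ : ℝ) / M ≤ v := by rw [div_le_iff₀ hM']; linarith
  refine ⟨⌊M * v⌋, ?_, ?_, ?_⟩
  · rw [Finset.mem_Icc]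
    refine ⟨by omega, ?_⟩
    have : (⌊M * v⌋ : ℝ) ≤ (M : ℤ) := by push_cast; nlinarith
    exact_mod_cast this
  · rw [abs_of_nonneg (by positivity), abs_of_nonneg h0]
    exact h5
  · rw [abs_of_nonneg (by linarith), sub_le_iff_le_add, ← add_div, le_div_iff₀ hM']
    linarith

/-- A grid of mesh `1 / M` in the Euclidean unit ball of dimension `p`. -/
lemma exists_grid_net (p M : ℕ) (hM : 0 < M) :
    ∃ G : Finset (Vec p), (∀ g ∈ G, ‖g‖ ≤ 1) ∧ G.card ≤ (2 * M + 1) ^ p ∧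
      ∀ v : Vec p, ‖v‖ ≤ 1 → ∃ g ∈ G, ‖v - g‖ ≤ Real.sqrt p / M := by
  classical
  have hM' : (0 : ℝ) < M := by exact_mod_cast hM
  let K : Finset (Fin p → ℤ) := Fintype.piFinset fun _ => Finset.Icc (-(M : ℤ)) M
  let F : (Fin p → ℤ) → Vec p := fun k => WithLp.toLp 2 fun j => (k j : ℝ) / M
  refine ⟨(K.image F).filter fun g => ‖g‖ ≤ 1, fun g hg => (Finset.mem_filter.1 hg).2, ?_, ?_⟩
  · refine (Finset.card_filter_le _ _).trans (Finset.card_image_le.trans ?_)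
    simp only [K, Fintype.card_piFinset, Int.card_Icc, Finset.prod_const, Finset.card_univ,
      Fintype.card_fin]
    refine Nat.pow_le_pow_left ?_ _
    omega
  · intro v hv
    have hvj : ∀ j, |v j| ≤ 1 := fun j => (PiLp.norm_apply_le v j).trans hv
    choose k hk h1 h2 using fun j => exists_int_div_near M hM (v j) (hvj j)
    refine ⟨F k, Finset.mem_filter.2 ⟨Finset.mem_image_of_mem _ (Fintype.mem_piFinset.2 hk), ?_⟩, ?_⟩
    · refine le_trans ?_ hv
      rw [EuclideanSpace.norm_eq, EuclideanSpace.norm_eq]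
      refine Real.sqrt_le_sqrt (Finset.sum_le_sum fun j _ => ?_)
      exact pow_le_pow_left₀ (norm_nonneg _) (h1 j) 2
    · rw [EuclideanSpace.norm_eq]
      have : ∑ j, ‖(v - F k) j‖ ^ 2 ≤ p * (1 / M : ℝ) ^ 2 := by
        refine (Finset.sum_le_card_nsmul _ _ _ fun j _ =>
          pow_le_pow_left₀ (norm_nonneg _) (h2 j) 2).trans ?_
        simp
      refine (Real.sqrt_le_sqrt this).trans ?_
      rw [Real.sqrt_mul (by positivity), Real.sqrt_sq (by positivity)]
      exact le_of_eq (by ring)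

/-! ### Spectral norms through quadratic forms -/

/-- Polarization writes 4⟪Tu, v⟫ as a difference of quadratic forms at u ± v. The parallelogram law
bounds it by 2B(‖u‖² + ‖v‖²) ≤ 4B, and v = Tu/‖Tu‖ recovers the norm. -/
lemma opNorm_le_of_quadratic {E : Type*} [NormedAddCommGroup E] [InnerProductSpace ℝ E]
    (T : E →L[ℝ] E) (hT : ∀ u v, ⟪T u, v⟫ = ⟪u, T v⟫) (B : ℝ) (hB : 0 ≤ B)
    (h : ∀ u : E, ‖u‖ ≤ 1 → |⟪u, T u⟫| ≤ B) : ‖T‖ ≤ B := by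
  have hq : ∀ u : E, |⟪u, T u⟫| ≤ B * ‖u‖ ^ 2 := by
    intro u
    rcases eq_or_ne u 0 with rfl | hu
    · simp
    have hu' : ‖u‖ ≠ 0 := norm_ne_zero_iff.2 hu
    have h1 := h (‖u‖⁻¹ • u) (by rw [norm_smul, norm_inv, norm_norm, inv_mul_cancel₀ hu'])
    rw [map_smul, real_inner_smul_left, real_inner_smul_right, ← mul_assoc, abs_mul] at h1
    have h2 : |‖u‖⁻¹ * ‖u‖⁻¹| = (‖u‖ ^ 2)⁻¹ := by
      rw [abs_of_nonneg (by positivity)]; field_simp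
    rw [h2, inv_mul_le_iff₀ (by positivity)] at h1
    linarith
  have hb : ∀ u v : E, ‖u‖ ≤ 1 → ‖v‖ ≤ 1 → ⟪T u, v⟫ ≤ B := by
    intro u v hu hv
    have e : 4 * ⟪T u, v⟫ = ⟪u + v, T (u + v)⟫ - ⟪u - v, T (u - v)⟫ := by
      simp only [map_add, map_sub, inner_add_left, inner_sub_left, inner_add_right,
        inner_sub_right]
      have := hT u v
      have h3 : ⟪v, T u⟫ = ⟪T u, v⟫ := real_inner_comm _ _
      linarith
    have h1 := (abs_le.1 (hq (u + v))).2
    have h2 := (abs_le.1 (hq (u - v))).1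
    have h3 := parallelogram_law_with_norm ℝ u v
    have h4 : ‖u‖ ^ 2 ≤ 1 := by nlinarith [norm_nonneg u]
    have h5 : ‖v‖ ^ 2 ≤ 1 := by nlinarith [norm_nonneg v]
    nlinarith
  refine T.opNorm_le_of_unit_norm hB fun u hu => ?_
  rcases eq_or_ne (T u) 0 with h0 | h0
  · simpa [h0] using hB
  have h1 := hb u (‖T u‖⁻¹ • T u) hu.le
    (by rw [norm_smul, norm_inv, norm_norm, inv_mul_cancel₀ (norm_ne_zero_iff.2 h0)])
  rw [real_inner_smul_right, real_inner_self_eq_norm_sq] at h1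
  have : ‖T u‖ ≠ 0 := norm_ne_zero_iff.2 h0
  field_simp at h1
  exact h1

/-- Moving both arguments of the form to a point at distance 1/4 costs 2 · ‖T‖/4, and this ‖T‖/2 is
absorbed on the left. -/
lemma opNorm_le_two_mul_of_net {E : Type*} [NormedAddCommGroup E] [InnerProductSpace ℝ E]
    (T : E →L[ℝ] E) (hT : ∀ u v, ⟪T u, v⟫ = ⟪u, T v⟫) (B : ℝ) (hB : 0 ≤ B) (G : Set E)
    (hG1 : ∀ g ∈ G, ‖g‖ ≤ 1) (hG : ∀ v : E, ‖v‖ ≤ 1 → ∃ g ∈ G, ‖v - g‖ ≤ 1 / 4)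
    (h : ∀ u ∈ G, |⟪u, T u⟫| ≤ B) : ‖T‖ ≤ 2 * B := by
  have : ‖T‖ ≤ B + ‖T‖ / 2 := by
    refine opNorm_le_of_quadratic T hT _ (by positivity) fun u hu => ?_
    obtain ⟨g, hg, hug⟩ := hG u hu
    have e : ⟪u, T u⟫ = ⟪g, T g⟫ + ⟪u - g, T u⟫ + ⟪g, T (u - g)⟫ := by
      simp only [map_sub, inner_sub_left, inner_sub_right]; ring
    have hTn : 0 ≤ ‖T‖ := norm_nonneg _
    have b1 : |⟪u - g, T u⟫| ≤ 1 / 4 * ‖T‖ :=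
      (abs_real_inner_le_norm _ _).trans (mul_le_mul hug
        ((T.le_opNorm u).trans (by nlinarith)) (norm_nonneg _) (by norm_num))
    have b2 : |⟪g, T (u - g)⟫| ≤ 1 * (‖T‖ * (1 / 4)) :=
      (abs_real_inner_le_norm _ _).trans (mul_le_mul (hG1 g hg)
        ((T.le_opNorm _).trans (by gcongr)) (norm_nonneg _) (by norm_num))
    rw [e]
    have := h g hg
    calc _ ≤ |⟪g, T g⟫| + |⟪u - g, T u⟫| + |⟪g, T (u - g)⟫| := abs_add_three _ _ _
      _ ≤ _ := by linarith
  linarith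

/-! ### A Bernstein inequality -/

/-- Integrating the second-order bound on the exponential requires no boundedness of `f`, only its
exponentially weighted second moment. The mean `m` cancels through 1 + lm + l²V ≤ exp(lm + l²V). -/
lemma mgf_centered_le {E : Type*} [MeasurableSpace E] (P : Measure E) [IsProbabilityMeasure P]
    (f : E → ℝ) (hf : Measurable f) (V l₀ : ℝ) (hfi : Integrable f P)
    (hVi : Integrable (fun z => f z ^ 2 * Real.exp (l₀ * |f z|)) P)
    (hV : ∫ z, f z ^ 2 * Real.exp (l₀ * |f z|) ∂P ≤ V) (l : ℝ) (hl : |l| ≤ l₀) :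
    Integrable (fun z => Real.exp (l * (f z - ∫ w, f w ∂P))) P ∧
    mgf (fun z => f z - ∫ w, f w ∂P) P l ≤ Real.exp (l ^ 2 * V) := by
  set m := ∫ w, f w ∂P with hm
  have hpt : ∀ z, Real.exp (l * f z)
      ≤ 1 + l * f z + l ^ 2 * (f z ^ 2 * Real.exp (l₀ * |f z|)) := by
    intro z
    refine (exp_le_one_add_add_sq_mul_exp_abs _).trans ?_
    rw [mul_pow, abs_mul, mul_assoc]
    gcongr
  have hi1 : Integrable (fun z => 1 + l * f z
      + l ^ 2 * (f z ^ 2 * Real.exp (l₀ * |f z|))) P :=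
    ((integrable_const _).add (hfi.const_mul _)).add (hVi.const_mul _)
  have hi2 : Integrable (fun z => Real.exp (l * f z)) P :=
    hi1.mono' (by fun_prop) (Filter.Eventually.of_forall fun z => by
      rw [Real.norm_eq_abs, Real.abs_exp]; exact hpt z)
  have e : ∀ z, Real.exp (l * (f z - m)) = Real.exp (-(l * m)) * Real.exp (l * f z) := by
    intro z; rw [← Real.exp_add]; congr 1; ring
  refine ⟨by simp_rw [e]; exact hi2.const_mul _, ?_⟩
  have h1 : ∫ z, Real.exp (l * f z) ∂P ≤ 1 + l * m + l ^ 2 * V := by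
    refine (integral_mono hi2 hi1 hpt).trans ?_
    rw [integral_add (f := fun z => 1 + l * f z) ((integrable_const _).add (hfi.const_mul _))
      (hVi.const_mul _), integral_add (integrable_const _) (hfi.const_mul _), integral_const_mul,
      integral_const_mul]
    simp only [integral_const, probReal_univ, smul_eq_mul, mul_one]
    nlinarith [sq_nonneg l]
  rw [mgf]
  simp_rw [e]
  rw [integral_const_mul]
  calc _ ≤ Real.exp (-(l * m)) * Real.exp (l * m + l ^ 2 * V) := by
        gcongr
        refine h1.trans ?_
        linarith [Real.add_one_le_exp (l * m + l ^ 2 * V)]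
    _ = _ := by rw [← Real.exp_add]; congr 1; ring

/-- Upper tail of an i.i.d. sum at one value of the Chernoff parameter. -/
lemma measure_sum_ge_le {E S : Type*} [MeasurableSpace E] [MeasurableSpace S]
    (P : Measure E) [IsProbabilityMeasure P] (μ : Measure S) [IsProbabilityMeasure μ]
    {n : ℕ} (ξ : Fin n → S → E) (hξ : ∀ i, Measurable (ξ i)) (hind : iIndepFun ξ μ)
    (hlaw : ∀ i, μ.map (ξ i) = P) (h : E → ℝ) (hh : Measurable h) (l v a : ℝ) (hl : 0 ≤ l)
    (hi : Integrable (fun z => Real.exp (l * h z)) P) (hm : mgf h P l ≤ Real.exp v) :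
    μ.real {s | a ≤ ∑ i, h (ξ i s)} ≤ Real.exp (-l * a + n * v) := by
  have hind' : iIndepFun (fun i s => h (ξ i s)) μ := hind.comp (fun _ => h) fun _ => hh
  have hmeas : ∀ i, Measurable (fun s => h (ξ i s)) := fun i => hh.comp (hξ i)
  have hint : ∀ i ∈ Finset.univ, Integrable (fun s => Real.exp (l * h (ξ i s))) μ := fun i _ => by
    have := hi
    rw [← hlaw i] at this
    exact this.comp_measurable (hξ i)
  have h1 := measure_ge_le_exp_mul_mgf (μ := μ) (X := ∑ i, fun s => h (ξ i s)) a hl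
    (hind'.integrable_exp_mul_sum hmeas hint)
  have h2 : mgf (∑ i, fun s => h (ξ i s)) μ l ≤ Real.exp (n * v) := by
    rw [hind'.mgf_sum hmeas Finset.univ, Real.exp_nat_mul]
    refine (Finset.prod_le_prod (g := fun _ => Real.exp v) (fun _ _ => mgf_nonneg)
      fun i _ => ?_).trans_eq (by simp)
    refine le_trans (le_of_eq ?_) hm
    rw [mgf, mgf, ← hlaw i, integral_map (hξ i).aemeasurable (by fun_prop)]
  simp only [Finset.sum_apply] at h1
  rw [Real.exp_add]
  exact h1.trans (by gcongr)

/-- The square-root part alone is handled by l = q/V. If this exceeds the admissible range, l = l₀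
is taken: then l₀V ≤ q makes the quadratic term harmless and the linear part x/(n l₀) supplies −x.
-/
lemma exists_bernstein_parameter (n V x l₀ : ℝ) (hn : 0 < n) (hV : 0 < V) (hx : 0 < x)
    (hl₀ : 0 < l₀) : ∃ l, 0 ≤ l ∧ l ≤ l₀ ∧
      -l * (n * (2 * Real.sqrt (V * x / n) + x / (n * l₀))) + n * (l ^ 2 * V) ≤ -x := by
  set q := Real.sqrt (V * x / n) with hq
  have hq2 : q ^ 2 * n = V * x := by
    rw [hq, Real.sq_sqrt (by positivity)]; field_simp
  have hq0 : 0 < q := Real.sqrt_pos.2 (by positivity)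
  rcases le_total (q / V) l₀ with h | h
  · refine ⟨q / V, by positivity, h, ?_⟩
    have e1 : q / V * n * q = x := by field_simp; linarith
    have e2 : n * ((q / V) ^ 2 * V) = x := by field_simp; linarith
    have e3 : 0 ≤ q / V * (n * (x / (n * l₀))) := by positivity
    rw [e2]
    nlinarith
  · refine ⟨l₀, hl₀.le, le_rfl, ?_⟩
    have e1 : l₀ * (n * (x / (n * l₀))) = x := by field_simp
    have e2 : l₀ * V ≤ q := by rwa [le_div_iff₀ hV] at h
    have e3 : n * (l₀ ^ 2 * V) ≤ l₀ * n * q := by nlinarith [mul_pos hn hl₀]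
    have e4 : 0 ≤ l₀ * n * q := by positivity
    nlinarith

theorem bernstein_mean {E S : Type*} [MeasurableSpace E] [MeasurableSpace S]
    (P : Measure E) [IsProbabilityMeasure P] (μ : Measure S) [IsProbabilityMeasure μ]
    {n : ℕ} (hn : 0 < n) (ξ : Fin n → S → E) (hξ : ∀ i, Measurable (ξ i)) (hind : iIndepFun ξ μ)
    (hlaw : ∀ i, μ.map (ξ i) = P) (f : E → ℝ) (hf : Measurable f) (V l₀ x : ℝ)
    (hV0 : 0 < V) (hl₀ : 0 < l₀) (hx : 0 < x) (hfi : Integrable f P)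
    (hVi : Integrable (fun z => f z ^ 2 * Real.exp (l₀ * |f z|)) P)
    (hV : ∫ z, f z ^ 2 * Real.exp (l₀ * |f z|) ∂P ≤ V) :
    μ.real {s | 2 * Real.sqrt (V * x / n) + x / (n * l₀)
      ≤ |(1 / (n : ℝ)) * ∑ i, f (ξ i s) - ∫ z, f z ∂P|} ≤ 2 * Real.exp (-x) := by
  have hn' : (0 : ℝ) < n := by exact_mod_cast hn
  set m := ∫ z, f z ∂P with hm
  set d := 2 * Real.sqrt (V * x / n) + x / (n * l₀) with hd
  obtain ⟨l, hl0, hl1, hl⟩ := exists_bernstein_parameter n V x l₀ hn' hV0 hx hl₀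
  have key : ∀ l', |l'| ≤ l₀ → Integrable (fun z => Real.exp (l' * (f z - m))) P ∧
      mgf (fun z => f z - m) P l' ≤ Real.exp (l' ^ 2 * V) :=
    fun l' h' => mgf_centered_le P f hf V l₀ hfi hVi hV l' h'
  obtain ⟨i1, m1⟩ := key l (by rwa [abs_of_nonneg hl0])
  obtain ⟨i2, m2⟩ := key (-l) (by rwa [abs_neg, abs_of_nonneg hl0])
  have t1 := measure_sum_ge_le P μ ξ hξ hind hlaw (fun z => f z - m) (by fun_prop) l (l ^ 2 * V)
    (n * d) hl0 i1 m1
  have t2 := measure_sum_ge_le P μ ξ hξ hind hlaw (fun z => -(f z - m)) (by fun_prop) l (l ^ 2 * V)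
    (n * d) hl0 (by convert i2 using 3; ring) (by
      refine le_trans (le_of_eq ?_) (m2.trans_eq (by rw [neg_sq]))
      rw [mgf, mgf]; simp only [mul_neg, neg_mul])
  have hs : {s | d ≤ |(1 / (n : ℝ)) * ∑ i, f (ξ i s) - m|} ⊆
      {s | n * d ≤ ∑ i, (f (ξ i s) - m)} ∪ {s | n * d ≤ ∑ i, -(f (ξ i s) - m)} := by
    intro s hs
    have e : ∑ i, (f (ξ i s) - m) = n * ((1 / (n : ℝ)) * ∑ i, f (ξ i s) - m) := by
      rw [Finset.sum_sub_distrib]; simp; field_simp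
    simp only [Set.mem_union, Set.mem_ofPred_eq, Finset.sum_neg_distrib, e] at hs ⊢
    rcases le_abs.1 hs with h | h
    · left; gcongr
    · right; rw [← mul_neg]; gcongr
  calc _ ≤ _ := measureReal_mono hs
    _ ≤ _ := measureReal_union_le _ _
    _ ≤ Real.exp (-x) + Real.exp (-x) :=
        add_le_add (t1.trans (Real.exp_le_exp.2 hl)) (t2.trans (Real.exp_le_exp.2 hl))
    _ = _ := by ring

/-! ### Sub-Gaussian moments -/

/-- The integrand is the tail 2e^{−t²/2} times (t/4)e^{t²/8}, the derivative of e^{t²/8}. Its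
antiderivative is −(2/3)e^{−3t²/8}. -/
lemma integrableOn_and_integral_subgaussian_tail :
    IntegrableOn (fun t : ℝ => t / 2 * Real.exp (-(3 * t ^ 2 / 8))) (Set.Ioi 0) ∧
    ∫ t in Set.Ioi (0 : ℝ), t / 2 * Real.exp (-(3 * t ^ 2 / 8)) = 2 / 3 := by
  have hd : ∀ t ∈ Set.Ici (0 : ℝ), HasDerivAt (fun t : ℝ => -(2 / 3) * Real.exp (-(3 * t ^ 2 / 8)))
      (t / 2 * Real.exp (-(3 * t ^ 2 / 8))) t := by
    intro t _
    have h := (((((hasDerivAt_pow 2 t).const_mul 3).div_const 8).neg).exp).const_mul (-(2 / 3 : ℝ))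
    refine h.congr_deriv ?_
    simp only [Pi.neg_apply]
    push_cast
    ring
  have hpos : ∀ t ∈ Set.Ioi (0 : ℝ), 0 ≤ t / 2 * Real.exp (-(3 * t ^ 2 / 8)) := fun t ht => by
    have : 0 < t := ht
    positivity
  have hlim : Filter.Tendsto (fun t : ℝ => -(2 / 3) * Real.exp (-(3 * t ^ 2 / 8))) Filter.atTop
      (nhds (-(2 / 3) * 0)) := by
    refine (Real.tendsto_exp_atBot.comp ?_).const_mul _
    refine Filter.tendsto_neg_atTop_atBot.comp ?_
    exact ((Filter.tendsto_pow_atTop (two_ne_zero)).const_mul_atTop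
      (by norm_num : (0 : ℝ) < 3)).atTop_div_const (by norm_num)
  refine ⟨integrableOn_Ioi_deriv_of_nonneg' hd hpos hlim, ?_⟩
  rw [integral_Ioi_of_hasDerivAt_of_nonneg' hd hpos hlim]
  norm_num

/-- Layer-cake formula for e^{t²/8} − 1 at t = |Z|/υ: the tail integral is 2/3, and 1 + 2/3 is
rounded up to 3. -/
lemma exp_sq_integrable_of_subgaussian {E : Type*} [MeasurableSpace E] (Q : Measure E)
    [IsProbabilityMeasure Q] (Z : E → ℝ) (hZ : Measurable Z) (υ : ℝ) (hυ : 0 < υ)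
    (h : ∀ t : ℝ, 0 ≤ t → Q.real {x | υ * t ≤ |Z x|} ≤ 2 * Real.exp (-t ^ 2 / 2)) :
    Integrable (fun x => Real.exp (Z x ^ 2 / (8 * υ ^ 2))) Q ∧
    ∫ x, Real.exp (Z x ^ 2 / (8 * υ ^ 2)) ∂Q ≤ 3 := by
  have hder : ∀ T : ℝ, ∫ t in (0 : ℝ)..T, t / 4 * Real.exp (t ^ 2 / 8) = Real.exp (T ^ 2 / 8) - 1 := by
    intro T
    rw [intervalIntegral.integral_eq_sub_of_hasDerivAt (f := fun t : ℝ => Real.exp (t ^ 2 / 8))]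
    · simp
    · intro t _
      have h := (((hasDerivAt_pow 2 t).div_const 8)).exp
      refine h.congr_deriv ?_
      push_cast
      ring
    · exact Continuous.intervalIntegrable (by fun_prop) _ _
  have lc := lintegral_comp_eq_lintegral_meas_le_mul Q (f := fun x => |Z x| / υ)
    (g := fun t : ℝ => t / 4 * Real.exp (t ^ 2 / 8))
    (Filter.Eventually.of_forall fun x => by positivity) (by fun_prop)
    (fun t _ => Continuous.intervalIntegrable (by fun_prop) _ _)
    ((ae_restrict_iff' measurableSet_Ioi).2 (Filter.Eventually.of_forall fun t ht => by
      have : 0 < t := ht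
      positivity))
  have e : ∀ x, Z x ^ 2 / (8 * υ ^ 2) = (|Z x| / υ) ^ 2 / 8 := by
    intro x; rw [div_pow, sq_abs]; field_simp
  have hle : ∫⁻ x, ENNReal.ofReal (Real.exp (Z x ^ 2 / (8 * υ ^ 2)) - 1) ∂Q
      ≤ ENNReal.ofReal (2 / 3) := by
    simp_rw [hder, ← e] at lc
    rw [lc, ← integrableOn_and_integral_subgaussian_tail.2,
      ofReal_integral_eq_lintegral_ofReal integrableOn_and_integral_subgaussian_tail.1
      ((ae_restrict_iff' measurableSet_Ioi).2 (Filter.Eventually.of_forall fun t ht => by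
        have : 0 < t := ht
        positivity))]
    refine setLIntegral_mono (by fun_prop) fun t ht => ?_
    have ht0 : 0 < t := ht
    have h1 : Q {x | t ≤ |Z x| / υ} ≤ ENNReal.ofReal (2 * Real.exp (-t ^ 2 / 2)) := by
      rw [← ofReal_measureReal]
      refine ENNReal.ofReal_le_ofReal ((le_of_eq ?_).trans (h t ht0.le))
      simp_rw [le_div_iff₀ hυ, mul_comm t υ]
    calc _ ≤ ENNReal.ofReal (2 * Real.exp (-t ^ 2 / 2))
          * ENNReal.ofReal (t / 4 * Real.exp (t ^ 2 / 8)) := by gcongr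
      _ = _ := by
        rw [← ENNReal.ofReal_mul (by positivity)]
        congr 1
        have : Real.exp (-(3 * t ^ 2 / 8)) = Real.exp (-t ^ 2 / 2) * Real.exp (t ^ 2 / 8) := by
          rw [← Real.exp_add]; congr 1; ring
        rw [this]; ring
  have hnn : ∀ x, 0 ≤ Real.exp (Z x ^ 2 / (8 * υ ^ 2)) - 1 := fun x =>
    sub_nonneg.2 (Real.one_le_exp (by positivity))
  have hi : Integrable (fun x => Real.exp (Z x ^ 2 / (8 * υ ^ 2)) - 1) Q := by
    refine ⟨by fun_prop, ?_⟩
    rw [hasFiniteIntegral_iff_ofReal (Filter.Eventually.of_forall hnn)]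
    exact hle.trans_lt ENNReal.ofReal_lt_top
  have hi' : Integrable (fun x => Real.exp (Z x ^ 2 / (8 * υ ^ 2))) Q := by
    simpa [Pi.add_def] using hi.add (integrable_const (1 : ℝ))
  refine ⟨hi', ?_⟩
  have h2 : ∫ x, (Real.exp (Z x ^ 2 / (8 * υ ^ 2)) - 1) ∂Q ≤ 2 / 3 := by
    rw [integral_eq_lintegral_of_nonneg_ae (Filter.Eventually.of_forall hnn) hi.1]
    exact ENNReal.toReal_le_of_le_ofReal (by norm_num) hle
  rw [integral_sub hi' (integrable_const _)] at h2
  simp at h2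
  linarith

/-- Polynomial-times-exponential envelope of products of sub-Gaussian variables. -/
noncomputable def envelope (υ M : ℝ) : ℝ := 27 * (1 + M) ^ 7 * Real.exp (M ^ 2 / (16 * υ ^ 2))

/-- Bound for the mean of `envelope` at the maximum of three sub-Gaussian variables. -/
noncomputable def envelopeConst (υ : ℝ) : ℝ := 9 * (27 * (32 * υ ^ 2) ^ 4 * 256)

/-- Half of the available exponent M²/(8υ²) is kept in reserve by the envelope, and that half, y =
M²/(16υ²), absorbs the polynomial factor. -/
lemma envelope_le (υ M : ℝ) (hυ : 1 ≤ υ) (hM : 0 ≤ M) :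
    envelope υ M ≤ 27 * (32 * υ ^ 2) ^ 4 * 256 * Real.exp (M ^ 2 / (8 * υ ^ 2)) := by
  set y := M ^ 2 / (16 * υ ^ 2) with hy
  have hy0 : 0 ≤ y := by positivity
  have h1 : (1 + M) ^ 2 ≤ 32 * υ ^ 2 * (1 + y) := by
    have : 32 * υ ^ 2 * y = 2 * M ^ 2 := by rw [hy]; field_simp; ring
    nlinarith [sq_nonneg (M - 1)]
  have h2 : 1 + y ≤ 4 * Real.exp (y / 4) := by
    have := Real.add_one_le_exp (y / 4); linarith
  have h3 : (1 + y) ^ 4 ≤ 256 * Real.exp y := by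
    calc (1 + y) ^ 4 ≤ (4 * Real.exp (y / 4)) ^ 4 := by gcongr
      _ = _ := by rw [mul_pow, ← Real.exp_nat_mul]; norm_num; ring_nf
  have h4 : (1 + M) ^ 7 ≤ (32 * υ ^ 2) ^ 4 * (256 * Real.exp y) := by
    calc (1 + M) ^ 7 ≤ (1 + M) ^ 8 := pow_le_pow_right₀ (by linarith) (by norm_num)
      _ = ((1 + M) ^ 2) ^ 4 := by ring
      _ ≤ (32 * υ ^ 2 * (1 + y)) ^ 4 := by gcongr
      _ = (32 * υ ^ 2) ^ 4 * (1 + y) ^ 4 := by ring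
      _ ≤ _ := by gcongr
  have h5 : Real.exp (M ^ 2 / (8 * υ ^ 2)) = Real.exp y * Real.exp y := by
    rw [← Real.exp_add]; congr 1; rw [hy]; field_simp; ring
  rw [h5, envelope, ← hy]
  nlinarith [Real.exp_pos y]

/-- The maximum is one of its three arguments, so the exponential at the maximum is below the sum of
three, each of mean at most 3. Hence the factor 9 in `envelopeConst`. -/
lemma envelope_integrable {E : Type*} [MeasurableSpace E] (Q : Measure E)
    (υ : ℝ) (hυ : 1 ≤ υ) (a b c : E → ℝ) (ha : Measurable a) (hb : Measurable b)
    (hc : Measurable c)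
    (ha' : Integrable (fun x => Real.exp (a x ^ 2 / (8 * υ ^ 2))) Q ∧
      ∫ x, Real.exp (a x ^ 2 / (8 * υ ^ 2)) ∂Q ≤ 3)
    (hb' : Integrable (fun x => Real.exp (b x ^ 2 / (8 * υ ^ 2))) Q ∧
      ∫ x, Real.exp (b x ^ 2 / (8 * υ ^ 2)) ∂Q ≤ 3)
    (hc' : Integrable (fun x => Real.exp (c x ^ 2 / (8 * υ ^ 2))) Q ∧
      ∫ x, Real.exp (c x ^ 2 / (8 * υ ^ 2)) ∂Q ≤ 3) :
    Integrable (fun x => envelope υ (max |a x| (max |b x| |c x|))) Q ∧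
    ∫ x, envelope υ (max |a x| (max |b x| |c x|)) ∂Q ≤ envelopeConst υ := by
  set k := 27 * (32 * υ ^ 2) ^ 4 * 256 with hk
  have hk0 : 0 ≤ k := by positivity
  have hpt : ∀ x, envelope υ (max |a x| (max |b x| |c x|)) ≤
      k * (Real.exp (a x ^ 2 / (8 * υ ^ 2)) + Real.exp (b x ^ 2 / (8 * υ ^ 2))
        + Real.exp (c x ^ 2 / (8 * υ ^ 2))) := by
    intro x
    refine (envelope_le υ _ hυ (by positivity)).trans ?_
    have := Real.exp_pos (a x ^ 2 / (8 * υ ^ 2))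
    have := Real.exp_pos (b x ^ 2 / (8 * υ ^ 2))
    have := Real.exp_pos (c x ^ 2 / (8 * υ ^ 2))
    gcongr
    rcases max_choice |a x| (max |b x| |c x|) with h | h
    · rw [h, sq_abs]; linarith
    · rw [h]
      rcases max_choice |b x| |c x| with h | h <;> (rw [h, sq_abs]; linarith)
  have hi : Integrable (fun x => k * (Real.exp (a x ^ 2 / (8 * υ ^ 2))
      + Real.exp (b x ^ 2 / (8 * υ ^ 2)) + Real.exp (c x ^ 2 / (8 * υ ^ 2)))) Q :=
    ((ha'.1.add hb'.1).add hc'.1).const_mul k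
  have hi' : Integrable (fun x => envelope υ (max |a x| (max |b x| |c x|))) Q := by
    refine hi.mono' (by unfold envelope; fun_prop) (Filter.Eventually.of_forall fun x => ?_)
    rw [Real.norm_eq_abs, abs_of_nonneg (by unfold envelope; positivity)]
    exact hpt x
  refine ⟨hi', (integral_mono hi' hi hpt).trans ?_⟩
  rw [integral_const_mul, integral_add (f := fun x => Real.exp (a x ^ 2 / (8 * υ ^ 2))
      + Real.exp (b x ^ 2 / (8 * υ ^ 2))) (ha'.1.add hb'.1) hc'.1, integral_add ha'.1 hb'.1,
    envelopeConst, ← hk]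
  nlinarith [ha'.2, hb'.2, hc'.2]

/-! ### Conditional moments -/

/-- After disintegration `g` leaves the inner integral. Working with `lintegral` yields
integrability and the bound together. -/
lemma integrable_mul_of_condKernel {E : Type*} [MeasurableSpace E] (P : Measure (E × ℝ))
    [IsProbabilityMeasure P] (g : E → ℝ) (hg : Measurable g) (hg0 : ∀ x, 0 ≤ g x)
    (hgi : Integrable g P.fst) (h : E × ℝ → ℝ) (hh : Measurable h) (hh0 : ∀ z, 0 ≤ h z)
    (c : ℝ) (hc : 0 ≤ c)
    (hcond : ∀ᵐ x ∂P.fst, ∫⁻ y, ENNReal.ofReal (h (x, y)) ∂(P.condKernel x) ≤ ENNReal.ofReal c) :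
    Integrable (fun z => g z.1 * h z) P ∧ ∫ z, g z.1 * h z ∂P ≤ c * ∫ x, g x ∂P.fst := by
  have key : ∫⁻ z, ENNReal.ofReal (g z.1 * h z) ∂P ≤ ENNReal.ofReal (c * ∫ x, g x ∂P.fst) := by
    rw [← Measure.lintegral_condKernel (by fun_prop), ENNReal.ofReal_mul hc,
      ofReal_integral_eq_lintegral_ofReal hgi (Filter.Eventually.of_forall hg0),
      ← lintegral_const_mul _ (by fun_prop)]
    refine lintegral_mono_ae (hcond.mono fun x hx => ?_)
    simp_rw [ENNReal.ofReal_mul (hg0 x)]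
    rw [lintegral_const_mul _ (by fun_prop), mul_comm]
    gcongr
  have h0 : 0 ≤ᵐ[P] fun z => g z.1 * h z :=
    Filter.Eventually.of_forall fun z => mul_nonneg (hg0 _) (hh0 z)
  refine ⟨⟨by fun_prop, ?_⟩, ?_⟩
  · rw [hasFiniteIntegral_iff_ofReal h0]
    exact key.trans_lt ENNReal.ofReal_lt_top
  · rw [integral_eq_lintegral_of_nonneg_ae h0 (by fun_prop)]
    exact ENNReal.toReal_le_of_le_ofReal
      (mul_nonneg hc (integral_nonneg hg0)) key

lemma cdf_quantile_eq (ν : Measure ℝ) [IsProbabilityMeasure ν] (α : ℝ) (h0 : 0 < α) (h1 : α < 1)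
    (hc : Continuous (cdf ν)) : cdf ν (quantile α ν) = α := by
  have hne : {y | α ≤ cdf ν y}.Nonempty := by
    obtain ⟨y, hy⟩ := ((tendsto_cdf_atTop ν).eventually (eventually_gt_nhds h1)).exists
    exact ⟨y, hy.le⟩
  have hbdd : BddBelow {y | α ≤ cdf ν y} := by
    obtain ⟨b, hb⟩ := ((tendsto_cdf_atBot ν).eventually (eventually_lt_nhds h0)).exists
    refine ⟨b, fun y hy => ?_⟩
    by_contra! hlt
    exact absurd (monotone_cdf ν hlt.le) (not_le.2 (hb.trans_le hy))
  refine le_antisymm ?_ ((isClosed_le continuous_const hc).csInf_mem hne hbdd)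
  by_contra! hgt
  have hev := hc.continuousAt.eventually (eventually_gt_nhds hgt)
  obtain ⟨y, hy1, hy2⟩ := (hev.filter_mono nhdsWithin_le_nhds).and
    (self_mem_nhdsWithin (s := Set.Iio (quantile α ν))) |>.exists
  exact absurd (csInf_le hbdd (le_of_lt hy1)) (not_le.2 hy2)

lemma integrable_min_sub {ν : Measure ℝ} [IsProbabilityMeasure ν] {q : ℝ}
    (hint : IntegrableOn (fun y : ℝ => y) (Set.Iic q) ν) :
    Integrable (fun y => min (y - q) 0) ν ∧
    ∫ y, min (y - q) 0 ∂ν = ∫ y in Set.Iic q, y ∂ν - q * ν.real (Set.Iic q) := by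
  have e : (fun y => min (y - q) 0) = (Set.Iic q).indicator fun y => y - q := by
    ext y
    by_cases hy : y ≤ q
    · rw [Set.indicator_of_mem (show y ∈ Set.Iic q from hy), min_eq_left (by linarith)]
    · rw [Set.indicator_of_notMem (show y ∉ Set.Iic q from hy), min_eq_right (by linarith)]
  have hi : IntegrableOn (fun y => y - q) (Set.Iic q) ν := hint.sub (integrable_const _)
  rw [e]
  refine ⟨hi.integrable_indicator measurableSet_Iic, ?_⟩
  rw [integral_indicator measurableSet_Iic, integral_sub hint (integrable_const _),
    integral_const]
  simp [mul_comm]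

/-- The negative part of the quantile residual has mean `α (ES - q)`. -/
lemma integral_min_sub_quantile (ν : Measure ℝ) [IsProbabilityMeasure ν] (α q : ℝ)
    (h0 : 0 < α) (h1 : α < 1) (hq : quantile α ν = q)
    (hc : Continuous fun t => cdf (ν.map fun y => y - q) t)
    (hint : IntegrableOn (fun y : ℝ => y) (Set.Iic q) ν) :
    ∫ y, min (y - q) 0 ∂ν = α * (expShortfall α ν - q) := by
  have hprob : IsProbabilityMeasure (ν.map fun y => y - q) :=
    Measure.isProbabilityMeasure_map (by fun_prop)
  have hc' : Continuous (cdf ν) := by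
    -- Continuity is given for the law of y − q; translation carries it to `ν`.
    have e : (cdf ν : ℝ → ℝ) = fun y => cdf (ν.map fun y => y - q) (y - q) := by
      ext y
      rw [cdf_eq_real, cdf_eq_real, map_measureReal_apply (by fun_prop) measurableSet_Iic]
      congr 1
      ext z; simp
    rw [e]
    exact hc.comp (by fun_prop)
  have hm : ν.real (Set.Iic q) = α := by
    rw [← cdf_eq_real, ← hq]; exact cdf_quantile_eq ν α h0 h1 hc'
  rw [(integrable_min_sub hint).2, hm, expShortfall, hq, ProbabilityTheory.cond, integral_smul_measure,
    ENNReal.toReal_inv, ← measureReal_def, hm, smul_eq_mul]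
  field_simp

lemma abs_sub_pow_three_le (a b : ℝ) : |a - b| ^ 3 ≤ 4 * (|a| ^ 3 + |b| ^ 3) := by
  have h := abs_sub a b
  have ha := abs_nonneg a
  have hb := abs_nonneg b
  calc |a - b| ^ 3 ≤ (|a| + |b|) ^ 3 := by gcongr
    _ ≤ _ := by nlinarith [mul_nonneg (add_nonneg ha hb) (sq_nonneg (|a| - |b|))]

lemma lintegral_abs_sub_integral_pow_three_le {E : Type*} [MeasurableSpace E] (ν : Measure E)
    [IsProbabilityMeasure ν] (g : E → ℝ) (hg : Measurable g) (hgi : Integrable g ν) (c : ℝ)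
    (hc : 0 ≤ c) (h : ∫⁻ y, ENNReal.ofReal (|g y| ^ 3) ∂ν ≤ ENNReal.ofReal c) :
    ∫⁻ y, ENNReal.ofReal (|g y - ∫ z, g z ∂ν| ^ 3) ∂ν ≤ ENNReal.ofReal (8 * c) := by
  set m := ∫ z, g z ∂ν with hm
  have hi : Integrable (fun y => |g y| ^ 3) ν := by
    refine ⟨by fun_prop, ?_⟩
    rw [hasFiniteIntegral_iff_ofReal (Filter.Eventually.of_forall fun y => by positivity)]
    exact h.trans_lt ENNReal.ofReal_lt_top
  have hle : ∫ y, |g y| ^ 3 ∂ν ≤ c := by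
    rw [integral_eq_lintegral_of_nonneg_ae (Filter.Eventually.of_forall fun y => by positivity)
      hi.1]
    exact ENNReal.toReal_le_of_le_ofReal hc h
  have hm3 : |m| ^ 3 ≤ c := by
    have h1 : |m| ≤ ∫ y, |g y| ∂ν := abs_integral_le_integral_abs
    set k := ∫ y, |g y| ∂ν with hk
    have hk0 : 0 ≤ k := (abs_nonneg _).trans h1
    -- Jensen by hand: the integrand on the left is the tangent line of t³ at k, and t³ − 3k²t + 2k³
    -- = (t − k)²(t + 2k).
    have h2 : ∫ y, (3 * k ^ 2 * |g y| - 2 * k ^ 3) ∂ν ≤ ∫ y, |g y| ^ 3 ∂ν := by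
      refine integral_mono ((hgi.abs.const_mul _).sub (integrable_const _)) hi fun y => ?_
      have := abs_nonneg (g y)
      change 3 * k ^ 2 * |g y| - 2 * k ^ 3 ≤ |g y| ^ 3
      nlinarith [mul_nonneg (sq_nonneg (|g y| - k)) (by positivity : 0 ≤ |g y| + 2 * k)]
    rw [integral_sub (hgi.abs.const_mul _) (integrable_const _), integral_const_mul, ← hk] at h2
    simp at h2
    calc |m| ^ 3 ≤ k ^ 3 := by gcongr
      _ ≤ c := by nlinarith
  have hi4 : Integrable (fun y => 4 * (|g y| ^ 3 + |m| ^ 3)) ν :=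
    (hi.add (integrable_const _)).const_mul 4
  calc _ ≤ ∫⁻ y, ENNReal.ofReal (4 * (|g y| ^ 3 + |m| ^ 3)) ∂ν :=
        lintegral_mono fun y => ENNReal.ofReal_le_ofReal (abs_sub_pow_three_le _ _)
    _ = ENNReal.ofReal (∫ y, 4 * (|g y| ^ 3 + |m| ^ 3) ∂ν) :=
        (ofReal_integral_eq_lintegral_ofReal hi4
          (Filter.Eventually.of_forall fun y => by positivity)).symm
    _ ≤ _ := by
        refine ENNReal.ofReal_le_ofReal ?_
        rw [integral_const_mul, integral_add hi (integrable_const _)]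
        simp
        linarith

/-- The indicator jumps only where its cofactor vanishes, so the residual is Lipschitz in the
parameters despite its form. -/
lemma esResid_eq_min {p : ℕ} (α : ℝ) (β θ x : Vec p) (y : ℝ) :
    esResid α β θ x y = min (y - ⟪x, β⟫) 0 + α * ⟪x, β - θ⟫ := by
  unfold esResid
  split_ifs with h
  · rw [mul_one, min_eq_left h]
  · rw [mul_zero, min_eq_right (not_le.1 h).le]

lemma measurable_esResid {p : ℕ} (α : ℝ) (β θ : Vec p) :
    Measurable fun z : Vec p × ℝ => esResid α β θ z.1 z.2 := by
  simp_rw [esResid_eq_min]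
  fun_prop

/-- Conditional second and third moments of the true expected-shortfall residual. -/
lemma condKernel_esResid_moments {p : ℕ} (P : Measure (Vec p × ℝ)) [IsProbabilityMeasure P]
    (α : ℝ) (h0 : 0 < α) (h1 : α < 1) (βstar θstar : Vec p) (fbar σbar α₃ : ℝ) (hα₃ : 0 < α₃)
    (hJ : JointModel P α βstar θstar) (hD : CondDistribution P βstar fbar σbar)
    (hT : ThirdMoment P βstar α₃) :
    ∀ᵐ x ∂P.fst,
      ∫⁻ y, ENNReal.ofReal (esResid α βstar θstar x y ^ 2) ∂(P.condKernel x)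
        ≤ ENNReal.ofReal (σbar ^ 2) ∧
      ∫⁻ y, ENNReal.ofReal (|esResid α βstar θstar x y| ^ 3) ∂(P.condKernel x)
        ≤ ENNReal.ofReal (8 * α₃) := by
  filter_upwards [hJ, hD, hT] with x hJx hDx hTx
  obtain ⟨hq, hint, hes⟩ := hJx
  obtain ⟨hcd, -, hvar⟩ := hDx
  rw [hq] at hint
  have hmean := integral_min_sub_quantile (P.condKernel x) α ⟪x, βstar⟫ h0 h1 hq
    hcd.continuous hint
  obtain ⟨hgi, -⟩ := integrable_min_sub hint
  -- The shortfall model makes the true residual the conditionally centred negative part, so its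
  -- second moment is exactly the conditional variance.
  have hres : ∀ y, esResid α βstar θstar x y = min (y - ⟪x, βstar⟫) 0
      - ∫ z, min (z - ⟪x, βstar⟫) 0 ∂(P.condKernel x) := by
    intro y
    rw [esResid_eq_min, hmean, hes, inner_sub_right]
    ring
  refine ⟨?_, ?_⟩
  · rw [evariance, condErr, lintegral_map (by fun_prop) (by fun_prop),
      integral_map (by fun_prop) (by fun_prop)] at hvar
    refine (lintegral_congr fun y => ?_).trans_le hvar
    rw [hres, ← Real.enorm_of_nonneg (by positivity), enorm_pow]
  · rw [condErr, lintegral_map (by fun_prop) (by fun_prop)] at hTx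
    simp_rw [hres]
    exact lintegral_abs_sub_integral_pow_three_le _ _ (by fun_prop) hgi _ hα₃.le hTx

/-! ### The squared truncated residual -/

lemma huberScore_sq (γ t : ℝ) : huberScore γ t ^ 2 = min |t| γ ^ 2 ∨ t = 0 := by
  rcases lt_trichotomy t 0 with h | h | h
  · left; rw [huberScore, Real.sign_of_neg h]; ring
  · exact Or.inr h
  · left; rw [huberScore, Real.sign_of_pos h]; ring

lemma huberScore_sq_eq {γ : ℝ} (hγ : 0 < γ) (t : ℝ) : huberScore γ t ^ 2 = min |t| γ ^ 2 := by
  rcases huberScore_sq γ t with h | rfl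
  · exact h
  · simp [huberScore, hγ.le]

lemma measurable_huberScore_sq {γ : ℝ} (hγ : 0 < γ) : Measurable fun t => huberScore γ t ^ 2 := by
  simp_rw [huberScore_sq_eq hγ]
  fun_prop

lemma huberScore_sq_le {γ : ℝ} (hγ : 0 < γ) (t : ℝ) : huberScore γ t ^ 2 ≤ γ ^ 2 := by
  rw [huberScore_sq_eq hγ]
  have : 0 ≤ min |t| γ := le_min (abs_nonneg _) hγ.le
  exact pow_le_pow_left₀ this (min_le_right _ _) 2

/-- One of four factors is bounded by γ and three by |t|; third moments thus replace fourth moments,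
at the price of the √γ in the rate. -/
lemma huberScore_sq_sq_le {γ : ℝ} (hγ : 0 < γ) (t : ℝ) :
    (huberScore γ t ^ 2) ^ 2 ≤ γ * |t| ^ 3 := by
  rw [huberScore_sq_eq hγ]
  have h0 : 0 ≤ min |t| γ := le_min (abs_nonneg _) hγ.le
  calc (min |t| γ ^ 2) ^ 2 = min |t| γ * min |t| γ ^ 3 := by ring
    _ ≤ _ := by
      gcongr
      · exact min_le_right _ _
      · exact min_le_left _ _

/-- There is no error for |t| ≤ γ; beyond, t² ≤ |t|³/γ. This is the source of α₃/γ. -/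
lemma abs_huberScore_sq_sub_sq_le {γ : ℝ} (hγ : 0 < γ) (t : ℝ) :
    |huberScore γ t ^ 2 - t ^ 2| ≤ |t| ^ 3 / γ := by
  rw [huberScore_sq_eq hγ, ← sq_abs t]
  rcases le_total |t| γ with h | h
  · rw [min_eq_left h]; simp; positivity
  · rw [min_eq_right h, abs_sub_comm, abs_of_nonneg (by nlinarith), le_div_iff₀ hγ]
    nlinarith [pow_pos hγ 3, sq_nonneg |t|, abs_nonneg t, mul_nonneg (sq_nonneg |t|) (sub_nonneg.2 h)]

lemma abs_min_sub_min_le (γ s t : ℝ) : |min |s| γ - min |t| γ| ≤ |s - t| :=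
  (abs_min_sub_min_le_max _ _ _ _).trans
    (max_le (abs_abs_sub_abs_le_abs_sub s t) (by simp))

/-- This form, free of γ, serves for the bias; the next one, with slope 2γ, serves for the
discretization. -/
lemma abs_huberScore_sq_sub_le {γ : ℝ} (hγ : 0 < γ) (s t : ℝ) :
    |huberScore γ s ^ 2 - huberScore γ t ^ 2| ≤ |s - t| * (|s| + |t|) := by
  rw [huberScore_sq_eq hγ, huberScore_sq_eq hγ, sq_sub_sq, mul_comm, abs_mul]
  refine mul_le_mul (abs_min_sub_min_le _ _ _) ?_ (abs_nonneg _) (abs_nonneg _)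
  · rw [abs_of_nonneg (add_nonneg (le_min (abs_nonneg _) hγ.le) (le_min (abs_nonneg _) hγ.le))]
    exact add_le_add (min_le_left _ _) (min_le_left _ _)

lemma abs_huberScore_sq_sub_le' {γ : ℝ} (hγ : 0 < γ) (s t : ℝ) :
    |huberScore γ s ^ 2 - huberScore γ t ^ 2| ≤ 2 * γ * |s - t| := by
  rw [huberScore_sq_eq hγ, huberScore_sq_eq hγ, sq_sub_sq, abs_mul]
  refine mul_le_mul ?_ (abs_min_sub_min_le _ _ _) (abs_nonneg _) (by positivity)
  rw [abs_of_nonneg (add_nonneg (le_min (abs_nonneg _) hγ.le) (le_min (abs_nonneg _) hγ.le))]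
  linarith [min_le_right |s| γ, min_le_right |t| γ]

lemma abs_esResid_sub_le {p : ℕ} (α : ℝ) (h0 : 0 < α) (h1 : α < 1) (β θ β' θ' x : Vec p) (y : ℝ) :
    |esResid α β θ x y - esResid α β' θ' x y| ≤ 2 * |⟪x, β - β'⟫| + |α * ⟪x, θ - θ'⟫| := by
  rw [esResid_eq_min, esResid_eq_min]
  have e : min (y - ⟪x, β⟫) 0 + α * ⟪x, β - θ⟫ - (min (y - ⟪x, β'⟫) 0 + α * ⟪x, β' - θ'⟫)
      = (min (y - ⟪x, β⟫) 0 - min (y - ⟪x, β'⟫) 0) + α * ⟪x, β - β'⟫ + -(α * ⟪x, θ - θ'⟫) := by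
    simp only [inner_sub_right]; ring
  have h2 : |min (y - ⟪x, β⟫) 0 - min (y - ⟪x, β'⟫) 0| ≤ |⟪x, β - β'⟫| := by
    refine (abs_min_sub_min_le_max _ _ _ _).trans (max_le (le_of_eq ?_) (by simp))
    rw [inner_sub_right, ← abs_neg]; congr 1; ring
  have h3 : |α * ⟪x, β - β'⟫| ≤ |⟪x, β - β'⟫| := by
    rw [abs_mul, abs_of_pos h0]
    exact mul_le_of_le_one_left (abs_nonneg _) h1.le
  rw [e]
  refine (abs_add_three _ _ _).trans ?_
  rw [abs_neg]
  linarith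

/-- These are the weights met in the bias and variance computations. With 2|b| + |c| ≤ 3M each
polynomial part has degree at most 4 + 3 = 7 and coefficient at most 27, so one envelope serves all.
-/
lemma envelope_bounds (υ a b c : ℝ) :
    a ^ 2 ≤ envelope υ (max |a| (max |b| |c|)) ∧
    a ^ 2 * (2 * |b| + |c|) ≤ envelope υ (max |a| (max |b| |c|)) ∧
    a ^ 2 * (2 * |b| + |c|) ^ 2 ≤ envelope υ (max |a| (max |b| |c|)) ∧
    a ^ 4 * Real.exp (a ^ 2 / (16 * υ ^ 2)) ≤ envelope υ (max |a| (max |b| |c|)) ∧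
    a ^ 4 * (2 * |b| + |c|) ^ 3 * Real.exp (a ^ 2 / (16 * υ ^ 2))
      ≤ envelope υ (max |a| (max |b| |c|)) := by
  set M := max |a| (max |b| |c|) with hM
  have ha : |a| ≤ M := le_max_left _ _
  have hb : |b| ≤ M := (le_max_left _ _).trans (le_max_right _ _)
  have hc : |c| ≤ M := (le_max_right _ _).trans (le_max_right _ _)
  have hM0 : 0 ≤ M := (abs_nonneg a).trans ha
  have hd : 2 * |b| + |c| ≤ 3 * M := by linarith
  have ha2 : a ^ 2 ≤ M ^ 2 := by rw [← sq_abs]; gcongr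
  have ha4 : a ^ 4 ≤ M ^ 4 := by
    calc a ^ 4 = (a ^ 2) ^ 2 := by ring
      _ ≤ (M ^ 2) ^ 2 := by gcongr
      _ = _ := by ring
  have he : Real.exp (a ^ 2 / (16 * υ ^ 2)) ≤ Real.exp (M ^ 2 / (16 * υ ^ 2)) := by gcongr
  have hE : 1 ≤ Real.exp (M ^ 2 / (16 * υ ^ 2)) := Real.one_le_exp (by positivity)
  have hpow : ∀ k ≤ 7, M ^ k ≤ (1 + M) ^ 7 := fun k hk =>
    calc M ^ k ≤ (1 + M) ^ k := by gcongr; linarith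
      _ ≤ (1 + M) ^ 7 := pow_le_pow_right₀ (by linarith) hk
  have hΦ : 27 * (1 + M) ^ 7 ≤ envelope υ M := by
    unfold envelope
    exact le_mul_of_one_le_right (by positivity) hE
  have h7 : (0 : ℝ) ≤ (1 + M) ^ 7 := by positivity
  refine ⟨?_, ?_, ?_, ?_, ?_⟩
  · linarith [hpow 2 (by norm_num)]
  · calc a ^ 2 * (2 * |b| + |c|) ≤ M ^ 2 * (3 * M) := by gcongr
      _ ≤ _ := by nlinarith [hpow 3 (by norm_num)]
  · calc a ^ 2 * (2 * |b| + |c|) ^ 2 ≤ M ^ 2 * (3 * M) ^ 2 := by gcongr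
      _ = 9 * M ^ 4 := by ring
      _ ≤ _ := by linarith [hpow 4 (by norm_num)]
  · unfold envelope
    refine mul_le_mul ?_ he (Real.exp_pos _).le (by positivity)
    linarith [hpow 4 (by norm_num)]
  · unfold envelope
    refine mul_le_mul ?_ he (Real.exp_pos _).le (by positivity)
    calc a ^ 4 * (2 * |b| + |c|) ^ 3 ≤ M ^ 4 * (3 * M) ^ 3 := by gcongr
      _ = 27 * M ^ 7 := by ring
      _ ≤ _ := by linarith [hpow 7 (by norm_num)]

lemma integrable_comp_fst {E : Type*} [MeasurableSpace E] (P : Measure (E × ℝ)) (g : E → ℝ)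
    (hg : Measurable g) (hgi : Integrable g P.fst) :
    Integrable (fun z => g z.1) P ∧ ∫ z, g z.1 ∂P = ∫ x, g x ∂P.fst := by
  refine ⟨hgi.comp_measurable measurable_fst, ?_⟩
  rw [Measure.fst, integral_map measurable_fst.aemeasurable (by fun_prop)]

section Truncated

variable {E : Type*} [MeasurableSpace E] (P : Measure (E × ℝ)) [IsProbabilityMeasure P]
  (w₀ w : E × ℝ → ℝ) (hw₀ : Measurable w₀) (hw : Measurable w) (a b c : E → ℝ)
  (ha : Measurable a) (hb : Measurable b) (hc : Measurable c) (υ K r σ κ γ : ℝ)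
  (hr : 0 ≤ r) (hκ : 0 ≤ κ) (hγ : 0 < γ)
  (hclose : ∀ z, |w z - w₀ z| ≤ r * (2 * |b z.1| + |c z.1|))
  (hmom : ∀ᵐ x ∂P.fst, ∫⁻ y, ENNReal.ofReal (w₀ (x, y) ^ 2) ∂(P.condKernel x)
        ≤ ENNReal.ofReal (σ ^ 2) ∧
      ∫⁻ y, ENNReal.ofReal (|w₀ (x, y)| ^ 3) ∂(P.condKernel x) ≤ ENNReal.ofReal κ)
  (hΦ : Integrable (fun x => envelope υ (max |a x| (max |b x| |c x|))) P.fst ∧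
    ∫ x, envelope υ (max |a x| (max |b x| |c x|)) ∂P.fst ≤ K)

include hw₀ hw ha hb hc hr hκ hγ hclose hmom hΦ

/-- Mean of the weighted squared truncated residual. -/
lemma integral_truncated_sub_le (hσ : 0 < σ) :
    Integrable (fun z => huberScore γ (w z) ^ 2 * a z.1 ^ 2) P ∧
    |∫ z, huberScore γ (w z) ^ 2 * a z.1 ^ 2 ∂P - ∫ z, w₀ z ^ 2 * a z.1 ^ 2 ∂P|
      ≤ K * (κ / γ + 2 * r * σ + r ^ 2) := by
  set Φ : E → ℝ := fun x => envelope υ (max |a x| (max |b x| |c x|)) with hΦd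
  have hΦm : Measurable Φ := by simp only [hΦd, envelope]; fun_prop
  have hΦ0 : ∀ x, 0 ≤ Φ x := fun x => by simp only [hΦd, envelope]; positivity
  have hψm : Measurable fun z => huberScore γ (w z) ^ 2 := (measurable_huberScore_sq hγ).comp hw
  obtain ⟨i0, e0⟩ := integrable_comp_fst P Φ hΦm hΦ.1
  obtain ⟨i2, e2⟩ := integrable_mul_of_condKernel P Φ hΦm hΦ0 hΦ.1 (fun z => w₀ z ^ 2)
    (by fun_prop) (fun z => by positivity) (σ ^ 2) (by positivity) (hmom.mono fun x hx => hx.1)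
  obtain ⟨i3, e3⟩ := integrable_mul_of_condKernel P Φ hΦm hΦ0 hΦ.1 (fun z => |w₀ z| ^ 3)
    (by fun_prop) (fun z => by positivity) κ hκ (hmom.mono fun x hx => hx.2)
  have hf : Integrable (fun z => huberScore γ (w z) ^ 2 * a z.1 ^ 2) P := by
    refine (i0.const_mul (γ ^ 2)).mono' (by fun_prop) (Filter.Eventually.of_forall fun z => ?_)
    rw [Real.norm_eq_abs, abs_of_nonneg (by positivity)]
    exact mul_le_mul (huberScore_sq_le hγ _) (envelope_bounds υ _ _ _).1 (by positivity)
      (by positivity)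
  have hg : Integrable (fun z => w₀ z ^ 2 * a z.1 ^ 2) P := by
    refine i2.mono' (by fun_prop) (Filter.Eventually.of_forall fun z => ?_)
    rw [Real.norm_eq_abs, abs_of_nonneg (by positivity), mul_comm]
    exact mul_le_mul_of_nonneg_right (envelope_bounds υ _ _ _).1 (by positivity)
  refine ⟨hf, ?_⟩
  rw [← integral_sub hf hg]
  have hpt : ∀ z, |huberScore γ (w z) ^ 2 * a z.1 ^ 2 - w₀ z ^ 2 * a z.1 ^ 2| ≤
      (1 / γ * (Φ z.1 * |w₀ z| ^ 3) + r / σ * (Φ z.1 * w₀ z ^ 2)) + (r * σ + r ^ 2) * Φ z.1 := by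
    intro z
    obtain ⟨b1, b2, b3, -, -⟩ := envelope_bounds υ (a z.1) (b z.1) (c z.1)
    change _ ≤ Φ z.1 at b1
    change _ ≤ Φ z.1 at b2
    change _ ≤ Φ z.1 at b3
    set D := 2 * |b z.1| + |c z.1| with hD
    have hD0 : 0 ≤ D := by positivity
    have hcl := hclose z
    rw [← sub_mul, abs_mul, abs_of_nonneg (sq_nonneg (a z.1))]
    have h1 : |huberScore γ (w z) ^ 2 - w₀ z ^ 2|
        ≤ r * D * (2 * |w₀ z| + r * D) + |w₀ z| ^ 3 / γ := by
      have t1 := abs_huberScore_sq_sub_le hγ (w z) (w₀ z)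
      have t2 := abs_huberScore_sq_sub_sq_le hγ (w₀ z)
      have t3 : |w z| ≤ |w₀ z| + r * D := by
        have := abs_sub_abs_le_abs_sub (w z) (w₀ z); linarith
      calc _ ≤ |huberScore γ (w z) ^ 2 - huberScore γ (w₀ z) ^ 2|
            + |huberScore γ (w₀ z) ^ 2 - w₀ z ^ 2| := abs_sub_le _ _ _
        _ ≤ |w z - w₀ z| * (|w z| + |w₀ z|) + |w₀ z| ^ 3 / γ := add_le_add t1 t2
        _ ≤ _ := by
          gcongr ?_ + _
          exact mul_le_mul hcl (by linarith) (by positivity) (by positivity)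
    -- AM-GM weighted by σ, so that the conditional second moment suffices; after integration both
    -- halves contribute rσ.
    have h2 : 2 * |w₀ z| ≤ w₀ z ^ 2 / σ + σ := by
      rw [← sq_abs (w₀ z), ← sub_nonneg]
      have : |w₀ z| ^ 2 / σ + σ - 2 * |w₀ z| = (|w₀ z| - σ) ^ 2 / σ := by field_simp; ring
      rw [this]; positivity
    calc _ ≤ (r * D * (2 * |w₀ z| + r * D) + |w₀ z| ^ 3 / γ) * a z.1 ^ 2 := by gcongr
      _ = r * (2 * |w₀ z|) * (a z.1 ^ 2 * D) + r ^ 2 * (a z.1 ^ 2 * D ^ 2)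
          + |w₀ z| ^ 3 / γ * a z.1 ^ 2 := by ring
      _ ≤ r * (w₀ z ^ 2 / σ + σ) * Φ z.1 + r ^ 2 * Φ z.1 + |w₀ z| ^ 3 / γ * Φ z.1 := by
          gcongr
      _ = _ := by ring
  have ib : Integrable (fun z => (1 / γ * (Φ z.1 * |w₀ z| ^ 3) + r / σ * (Φ z.1 * w₀ z ^ 2))
      + (r * σ + r ^ 2) * Φ z.1) P :=
    ((i3.const_mul _).add (i2.const_mul _)).add (i0.const_mul _)
  refine (abs_integral_le_integral_abs.trans
    (integral_mono (hf.sub hg).abs ib hpt)).trans ?_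
  rw [integral_add (f := fun z => 1 / γ * (Φ z.1 * |w₀ z| ^ 3) + r / σ * (Φ z.1 * w₀ z ^ 2))
      ((i3.const_mul _).add (i2.const_mul _)) (i0.const_mul _),
    integral_add (i3.const_mul _) (i2.const_mul _), integral_const_mul, integral_const_mul,
    integral_const_mul, e0]
  have hK := hΦ.2
  have e2' := e2.trans (mul_le_mul_of_nonneg_left hK (by positivity))
  have e3' := e3.trans (mul_le_mul_of_nonneg_left hK hκ)
  calc _ ≤ 1 / γ * (κ * K) + r / σ * (σ ^ 2 * K) + (r * σ + r ^ 2) * K := by gcongr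
    _ = _ := by field_simp; ring

/-- Exponentially weighted second moment of the weighted squared truncated residual. -/
lemma integral_truncated_sq_mul_exp_le :
    Integrable (fun z => (huberScore γ (w z) ^ 2 * a z.1 ^ 2) ^ 2 *
      Real.exp (1 / (16 * υ ^ 2 * γ ^ 2) * |huberScore γ (w z) ^ 2 * a z.1 ^ 2|)) P ∧
    ∫ z, (huberScore γ (w z) ^ 2 * a z.1 ^ 2) ^ 2 *
      Real.exp (1 / (16 * υ ^ 2 * γ ^ 2) * |huberScore γ (w z) ^ 2 * a z.1 ^ 2|) ∂P
      ≤ 4 * γ * K * (κ + r ^ 3) := by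
  set Φ : E → ℝ := fun x => envelope υ (max |a x| (max |b x| |c x|)) with hΦd
  have hΦm : Measurable Φ := by simp only [hΦd, envelope]; fun_prop
  have hΦ0 : ∀ x, 0 ≤ Φ x := fun x => by simp only [hΦd, envelope]; positivity
  have hψm : Measurable fun z => huberScore γ (w z) ^ 2 := (measurable_huberScore_sq hγ).comp hw
  obtain ⟨i0, e0⟩ := integrable_comp_fst P Φ hΦm hΦ.1
  obtain ⟨i3, e3⟩ := integrable_mul_of_condKernel P Φ hΦm hΦ0 hΦ.1 (fun z => |w₀ z| ^ 3)
    (by fun_prop) (fun z => by positivity) κ hκ (hmom.mono fun x hx => hx.2)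
  have hpt : ∀ z, (huberScore γ (w z) ^ 2 * a z.1 ^ 2) ^ 2 *
      Real.exp (1 / (16 * υ ^ 2 * γ ^ 2) * |huberScore γ (w z) ^ 2 * a z.1 ^ 2|)
      ≤ 4 * γ * (Φ z.1 * |w₀ z| ^ 3) + 4 * γ * r ^ 3 * Φ z.1 := by
    intro z
    obtain ⟨-, -, -, b4, b5⟩ := envelope_bounds υ (a z.1) (b z.1) (c z.1)
    change _ ≤ Φ z.1 at b4
    change _ ≤ Φ z.1 at b5
    set D := 2 * |b z.1| + |c z.1| with hD
    have hD0 : 0 ≤ D := by positivity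
    have h1 : |w z| ^ 3 ≤ 4 * (|w₀ z| ^ 3 + r ^ 3 * D ^ 3) := by
      have t := abs_sub_pow_three_le (w₀ z) (w₀ z - w z)
      rw [sub_sub_cancel, abs_sub_comm (w₀ z)] at t
      have : |w z - w₀ z| ^ 3 ≤ (r * D) ^ 3 := pow_le_pow_left₀ (abs_nonneg _) (hclose z) 3
      rw [mul_pow] at this
      linarith
    -- The bound ψ_γ² ≤ γ² cancels γ from the exponent, leaving one that the envelope already
    -- carries.
    have h2 : 1 / (16 * υ ^ 2 * γ ^ 2) * |huberScore γ (w z) ^ 2 * a z.1 ^ 2|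
        ≤ a z.1 ^ 2 / (16 * υ ^ 2) := by
      rw [abs_of_nonneg (by positivity)]
      calc _ ≤ 1 / (16 * υ ^ 2 * γ ^ 2) * (γ ^ 2 * a z.1 ^ 2) := by
            gcongr ?_ * (?_ * ?_)
            exact huberScore_sq_le hγ _
        _ = _ := by field_simp
    set e := Real.exp (a z.1 ^ 2 / (16 * υ ^ 2)) with he
    calc _ ≤ (huberScore γ (w z) ^ 2 * a z.1 ^ 2) ^ 2 * e := by
          rw [he]; gcongr
      _ = (huberScore γ (w z) ^ 2) ^ 2 * (a z.1 ^ 4 * e) := by ring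
      _ ≤ γ * (4 * (|w₀ z| ^ 3 + r ^ 3 * D ^ 3)) * (a z.1 ^ 4 * e) := by
          gcongr
          exact (huberScore_sq_sq_le hγ _).trans (by gcongr)
      _ = 4 * γ * |w₀ z| ^ 3 * (a z.1 ^ 4 * e) + 4 * γ * r ^ 3 * (a z.1 ^ 4 * D ^ 3 * e) := by ring
      _ ≤ 4 * γ * |w₀ z| ^ 3 * Φ z.1 + 4 * γ * r ^ 3 * Φ z.1 := by gcongr
      _ = _ := by ring
  have ib : Integrable (fun z => 4 * γ * (Φ z.1 * |w₀ z| ^ 3) + 4 * γ * r ^ 3 * Φ z.1) P :=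
    (i3.const_mul _).add (i0.const_mul _)
  have hi : Integrable (fun z => (huberScore γ (w z) ^ 2 * a z.1 ^ 2) ^ 2 *
      Real.exp (1 / (16 * υ ^ 2 * γ ^ 2) * |huberScore γ (w z) ^ 2 * a z.1 ^ 2|)) P :=
    ib.mono' (by fun_prop) (Filter.Eventually.of_forall fun z => by
      rw [Real.norm_eq_abs, abs_of_nonneg (by positivity)]; exact hpt z)
  refine ⟨hi, (integral_mono hi ib hpt).trans ?_⟩
  rw [integral_add (i3.const_mul _) (i0.const_mul _), integral_const_mul, integral_const_mul, e0]
  have hK := hΦ.2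
  have e3' := e3.trans (mul_le_mul_of_nonneg_left hK hκ)
  calc _ ≤ 4 * γ * (κ * K) + 4 * γ * r ^ 3 * K := by gcongr
    _ = _ := by ring

end Truncated

/-! ### Linear algebra of the standardization -/

section Standardize

variable {p : ℕ} {S : Matrix (Fin p) (Fin p) ℝ}

lemma sqrtM_symm (S : Matrix (Fin p) (Fin p) ℝ) : (sqrtM S).transpose = sqrtM S := by
  have h : (sqrtM S).IsHermitian := (CFC.sqrt_nonneg S).isSelfAdjoint
  simpa [Matrix.IsHermitian, Matrix.conjTranspose_eq_transpose_of_trivial] using h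

lemma invSqrtM_symm (S : Matrix (Fin p) (Fin p) ℝ) : (invSqrtM S).transpose = invSqrtM S := by
  rw [invSqrtM, Matrix.transpose_nonsing_inv, sqrtM_symm]

lemma inner_toEuclideanCLM_transpose (A : Matrix (Fin p) (Fin p) ℝ) (u v : Vec p) :
    ⟪Matrix.toEuclideanCLM (n := Fin p) (𝕜 := ℝ) A u, v⟫
      = ⟪u, Matrix.toEuclideanCLM (n := Fin p) (𝕜 := ℝ) A.transpose v⟫ := by
  rw [real_inner_comm, Matrix.inner_toEuclideanCLM, Matrix.inner_toEuclideanCLM,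
    Matrix.dotProduct_mulVec, ← Matrix.mulVec_transpose, dotProduct_comm]

lemma isUnit_sqrtM_det (hS : S.PosDef) : IsUnit (sqrtM S).det := by
  rw [← Matrix.isUnit_iff_isUnit_det, sqrtM, CFC.isUnit_sqrt_iff S hS.posSemidef.nonneg]
  exact hS.isUnit

lemma inner_standardize_sqrtM (hS : S.PosDef) (x v : Vec p) :
    ⟪standardize S x, Matrix.toEuclideanCLM (n := Fin p) (𝕜 := ℝ) (sqrtM S) v⟫ = ⟪x, v⟫ := by
  rw [standardize, inner_toEuclideanCLM_transpose, invSqrtM_symm, ← mul_apply_eq_comp,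
    ← map_mul, invSqrtM, Matrix.nonsing_inv_mul _ (isUnit_sqrtM_det hS), map_one,
    one_apply_eq_self]

lemma inner_outer (v x : Vec p) :
    ⟪v, Matrix.toEuclideanCLM (n := Fin p) (𝕜 := ℝ) (outer x) v⟫ = ⟪v, x⟫ ^ 2 := by
  rw [Matrix.inner_toEuclideanCLM, PiLp.inner_apply, sq, Finset.sum_mul_sum]
  simp only [dotProduct, Matrix.mulVec, outer, Matrix.of_apply, Finset.mul_sum]
  refine Finset.sum_congr rfl fun i _ => Finset.sum_congr rfl fun j _ => ?_
  simp
  ring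

lemma inner_truncCov {n : ℕ} (α γ : ℝ) (x : Fin n → Vec p) (y : Fin n → ℝ) (β θ v : Vec p) :
    ⟪v, Matrix.toEuclideanCLM (n := Fin p) (𝕜 := ℝ) (truncCov α γ x y β θ) v⟫
      = 1 / n * ∑ i, huberScore γ (esResid α β θ (x i) (y i)) ^ 2 * ⟪v, x i⟫ ^ 2 := by
  rw [truncCov, map_smul, map_sum, smul_apply, real_inner_smul_right,
    sum_apply, inner_sum]
  congr 1
  refine Finset.sum_congr rfl fun i _ => ?_
  rw [map_smul, smul_apply, real_inner_smul_right, inner_outer]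

lemma inner_covScore (P : Measure (Vec p × ℝ)) (α : ℝ) (β θ v : Vec p)
    (hi : ∀ j k, Integrable (fun z => esResid α β θ z.1 z.2 ^ 2 * (z.1 j * z.1 k)) P) :
    ⟪v, Matrix.toEuclideanCLM (n := Fin p) (𝕜 := ℝ) (covScore P α β θ) v⟫
      = ∫ z, esResid α β θ z.1 z.2 ^ 2 * ⟪v, z.1⟫ ^ 2 ∂P := by
  have e : ∀ z : Vec p × ℝ, esResid α β θ z.1 z.2 ^ 2 * ⟪v, z.1⟫ ^ 2
      = ∑ j, ∑ k, v j * v k * (esResid α β θ z.1 z.2 ^ 2 * (z.1 j * z.1 k)) := by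
    intro z
    rw [PiLp.inner_apply, sq (∑ i, _), Finset.sum_mul_sum, Finset.mul_sum]
    refine Finset.sum_congr rfl fun j _ => ?_
    rw [Finset.mul_sum]
    refine Finset.sum_congr rfl fun k _ => ?_
    simp
    ring
  simp_rw [e]
  rw [integral_finsetSum _ fun j _ => integrable_finsetSum _ fun k _ => (hi j k).const_mul _,
    Matrix.inner_toEuclideanCLM]
  simp only [dotProduct, Matrix.mulVec, Finset.mul_sum]
  refine Finset.sum_congr rfl fun j _ => ?_
  rw [integral_finsetSum _ fun k _ => (hi j k).const_mul _]
  refine Finset.sum_congr rfl fun k _ => ?_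
  rw [integral_const_mul, covScore, Matrix.of_apply]
  ring

lemma truncCov_transpose {n : ℕ} (α γ : ℝ) (x : Fin n → Vec p) (y : Fin n → ℝ) (β θ : Vec p) :
    (truncCov α γ x y β θ).transpose = truncCov α γ x y β θ := by
  rw [truncCov, Matrix.transpose_smul, Matrix.transpose_sum]
  congr 1
  refine Finset.sum_congr rfl fun i _ => ?_
  rw [Matrix.transpose_smul]
  congr 1
  ext j k
  simp [outer, mul_comm]

lemma covScore_transpose (P : Measure (Vec p × ℝ)) (α : ℝ) (β θ : Vec p) :
    (covScore P α β θ).transpose = covScore P α β θ := by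
  ext j k
  simp only [covScore, Matrix.transpose_apply, Matrix.of_apply]
  congr 1
  ext z
  ring

/-- The standardized error norm is controlled by its quadratic form on a net. -/
lemma covError_le_of_net {n : ℕ} (P : Measure (Vec p × ℝ)) (α γ : ℝ) (βstar θstar : Vec p)
    (hi : ∀ j k, Integrable (fun z => esResid α βstar θstar z.1 z.2 ^ 2 * (z.1 j * z.1 k)) P)
    (x : Fin n → Vec p) (y : Fin n → ℝ) (β θ : Vec p) (B : ℝ) (hB : 0 ≤ B) (G : Set (Vec p))
    (hG1 : ∀ g ∈ G, ‖g‖ ≤ 1) (hG : ∀ v : Vec p, ‖v‖ ≤ 1 → ∃ g ∈ G, ‖v - g‖ ≤ 1 / 4)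
    (h : ∀ u ∈ G, |1 / n * ∑ i, huberScore γ (esResid α β θ (x i) (y i)) ^ 2
        * ⟪u, standardize (covX P) (x i)⟫ ^ 2
      - ∫ z, esResid α βstar θstar z.1 z.2 ^ 2 * ⟪u, standardize (covX P) z.1⟫ ^ 2 ∂P| ≤ B) :
    covError P α βstar θstar γ x y β θ ≤ 2 * B := by
  set R := invSqrtM (covX P) with hR
  set A := truncCov α γ x y β θ - covScore P α βstar θstar with hA
  have hAt : A.transpose = A := by
    rw [hA, Matrix.transpose_sub, truncCov_transpose, covScore_transpose]
  have hRt : R.transpose = R := invSqrtM_symm _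
  refine opNorm_le_two_mul_of_net _ (fun u v => ?_) B hB G hG1 hG fun u hu => ?_
  · rw [inner_toEuclideanCLM_transpose, Matrix.transpose_mul, Matrix.transpose_mul, hAt, hRt,
      Matrix.mul_assoc]
  · have hs : ∀ x' : Vec p, ⟪Matrix.toEuclideanCLM (n := Fin p) (𝕜 := ℝ) R u, x'⟫
        = ⟪u, standardize (covX P) x'⟫ := fun x' => by
      rw [inner_toEuclideanCLM_transpose, hRt, standardize]
    have e : ⟪u, Matrix.toEuclideanCLM (n := Fin p) (𝕜 := ℝ) (R * A * R) u⟫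
        = ⟪Matrix.toEuclideanCLM (n := Fin p) (𝕜 := ℝ) R u, Matrix.toEuclideanCLM (n := Fin p)
          (𝕜 := ℝ) A (Matrix.toEuclideanCLM (n := Fin p) (𝕜 := ℝ) R u)⟫ := by
      rw [inner_toEuclideanCLM_transpose, hRt, map_mul, map_mul]
      rfl
    rw [e, hA, map_sub, sub_apply, inner_sub_right, inner_truncCov,
      inner_covScore _ _ _ _ _ hi]
    simp_rw [hs]
    exact h u hu

end Standardize

/-! ### Uniform concentration over the local set -/

section Model

variable {p : ℕ} {P : Measure (Vec p × ℝ)}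

lemma measurable_standardize (S : Matrix (Fin p) (Fin p) ℝ) : Measurable (standardize S) :=
  (Matrix.toEuclideanCLM (n := Fin p) (𝕜 := ℝ) (invSqrtM S)).continuous.measurable

lemma measurable_inner_standardize (S : Matrix (Fin p) (Fin p) ℝ) (u : Vec p) :
    Measurable fun x => ⟪u, standardize S x⟫ := by
  have := measurable_standardize S
  fun_prop

lemma exp_sq_inner_standardize_integrable [IsProbabilityMeasure P] {υ : ℝ} (hυ : 1 ≤ υ)
    (hC : CondCovariate P υ) (u : Vec p) (hu : ‖u‖ ≤ 1) :
    Integrable (fun x => Real.exp (⟪u, standardize (covX P) x⟫ ^ 2 / (8 * υ ^ 2))) P.fst ∧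
    ∫ x, Real.exp (⟪u, standardize (covX P) x⟫ ^ 2 / (8 * υ ^ 2)) ∂P.fst ≤ 3 := by
  rcases eq_or_ne u 0 with rfl | hu0
  · simp
  refine exp_sq_integrable_of_subgaussian P.fst _ (measurable_inner_standardize _ _) υ
    (by linarith) fun t ht => ?_
  have hn : 0 < ‖u‖ := norm_pos_iff.2 hu0
  -- The tail bound is available for unit vectors only; normalizing a shorter `u` enlarges the
  -- projection.
  refine le_trans (measureReal_mono ?_) (hC.2.2 (‖u‖⁻¹ • u)
    (by rw [norm_smul, norm_inv, norm_norm, inv_mul_cancel₀ hn.ne']) t ht)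
  intro x hx
  simp only [Set.mem_ofPred_eq] at hx ⊢
  rw [real_inner_smul_left, abs_mul, abs_of_pos (inv_pos.2 hn)]
  exact hx.trans (le_mul_of_one_le_left (abs_nonneg _) ((one_le_inv₀ hn).2 hu))

lemma envelope_standardize_integrable [IsProbabilityMeasure P] {υ : ℝ} (hυ : 1 ≤ υ)
    (hC : CondCovariate P υ) (u b c : Vec p) (hu : ‖u‖ ≤ 1) (hb : ‖b‖ ≤ 1) (hc : ‖c‖ ≤ 1) :
    Integrable (fun x => envelope υ (max |⟪u, standardize (covX P) x⟫|
      (max |⟪b, standardize (covX P) x⟫| |⟪c, standardize (covX P) x⟫|))) P.fst ∧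
    ∫ x, envelope υ (max |⟪u, standardize (covX P) x⟫|
      (max |⟪b, standardize (covX P) x⟫| |⟪c, standardize (covX P) x⟫|)) ∂P.fst
      ≤ envelopeConst υ :=
  envelope_integrable P.fst υ hυ _ _ _ (measurable_inner_standardize _ _)
    (measurable_inner_standardize _ _) (measurable_inner_standardize _ _)
    (exp_sq_inner_standardize_integrable hυ hC u hu)
    (exp_sq_inner_standardize_integrable hυ hC b hb)
    (exp_sq_inner_standardize_integrable hυ hC c hc)

/-- The coefficient vector at standardized displacement `v` from `β`. -/
noncomputable def shift (S : Matrix (Fin p) (Fin p) ℝ) (β v : Vec p) : Vec p :=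
  β + Matrix.toEuclideanCLM (n := Fin p) (𝕜 := ℝ) (invSqrtM S) v

lemma inner_shift_sub (S : Matrix (Fin p) (Fin p) ℝ) (β v x : Vec p) :
    ⟪x, shift S β v - β⟫ = ⟪v, standardize S x⟫ := by
  rw [shift, add_sub_cancel_left, standardize, ← real_inner_comm, inner_toEuclideanCLM_transpose,
    invSqrtM_symm]

lemma inner_sub_eq_of_posDef {S : Matrix (Fin p) (Fin p) ℝ} (hS : S.PosDef) (β β' x : Vec p) :
    ⟪x, β' - β⟫ = ⟪Matrix.toEuclideanCLM (n := Fin p) (𝕜 := ℝ) (sqrtM S) (β' - β),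
      standardize S x⟫ := by
  rw [← inner_standardize_sqrtM hS, real_inner_comm]

lemma integrable_esResid_sq_mul [IsProbabilityMeasure P] (hL : MemLp (fun x : Vec p => x) 2 P.fst)
    (α : ℝ) (βstar θstar : Vec p) (σ : ℝ)
    (hmom : ∀ᵐ x ∂P.fst, ∫⁻ y, ENNReal.ofReal (esResid α βstar θstar x y ^ 2) ∂(P.condKernel x)
        ≤ ENNReal.ofReal (σ ^ 2)) (j k : Fin p) :
    Integrable (fun z => esResid α βstar θstar z.1 z.2 ^ 2 * (z.1 j * z.1 k)) P := by
  have hm := measurable_esResid α βstar θstar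
  obtain ⟨h, -⟩ := integrable_mul_of_condKernel P (fun x => ‖x‖ ^ 2) (by fun_prop)
    (fun x => by positivity) (hL.integrable_norm_pow two_ne_zero)
    (fun z => esResid α βstar θstar z.1 z.2 ^ 2) (by fun_prop) (fun z => by positivity) (σ ^ 2)
    (by positivity) hmom
  refine h.mono' (by fun_prop) (Filter.Eventually.of_forall fun z => ?_)
  rw [Real.norm_eq_abs, abs_mul, abs_of_nonneg (sq_nonneg (esResid _ _ _ _ _)), mul_comm, abs_mul,
    sq ‖z.1‖]
  have h1 := PiLp.norm_apply_le z.1 j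
  have h2 := PiLp.norm_apply_le z.1 k
  rw [Real.norm_eq_abs] at h1 h2
  gcongr

/-- Concentration of the quadratic form in direction `u` at the parameter with standardized
displacements `r b` and `r t / α`. -/
lemma quadratic_form_tail [IsProbabilityMeasure P] {υ : ℝ} (hυ : 1 ≤ υ) (hC : CondCovariate P υ)
    {α : ℝ} (h0 : 0 < α) (h1 : α < 1) (βstar θstar : Vec p) (σ α₃ γ r V x : ℝ) (hσ : 0 < σ)
    (hα₃ : 0 < α₃) (hγ : 0 < γ) (hr : 0 < r) (hx : 0 < x)
    (hmom : ∀ᵐ x ∂P.fst,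
      ∫⁻ y, ENNReal.ofReal (esResid α βstar θstar x y ^ 2) ∂(P.condKernel x)
        ≤ ENNReal.ofReal (σ ^ 2) ∧
      ∫⁻ y, ENNReal.ofReal (|esResid α βstar θstar x y| ^ 3) ∂(P.condKernel x)
        ≤ ENNReal.ofReal (8 * α₃))
    (hV : 4 * γ * envelopeConst υ * (8 * α₃ + r ^ 3) ≤ V)
    {S : Type*} [MeasurableSpace S] (μ : Measure S) [IsProbabilityMeasure μ] {n : ℕ} (hn : 0 < n)
    (ξ : Fin n → S → Vec p × ℝ) (hξ : ∀ i, Measurable (ξ i)) (hind : iIndepFun ξ μ)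
    (hlaw : ∀ i, μ.map (ξ i) = P) (u b t : Vec p) (hu : ‖u‖ ≤ 1) (hb : ‖b‖ ≤ 1) (ht : ‖t‖ ≤ 1) :
    μ.real {s | 2 * Real.sqrt (V * x / n) + 16 * υ ^ 2 * γ ^ 2 * (x / n)
        + envelopeConst υ * (8 * α₃ / γ + 2 * r * σ + r ^ 2)
      ≤ |1 / n * ∑ i, huberScore γ (esResid α (shift (covX P) βstar (r • b))
            (shift (covX P) θstar ((r / α) • t)) (ξ i s).1 (ξ i s).2) ^ 2
          * ⟪u, standardize (covX P) (ξ i s).1⟫ ^ 2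
        - ∫ z, esResid α βstar θstar z.1 z.2 ^ 2 * ⟪u, standardize (covX P) z.1⟫ ^ 2 ∂P|}
      ≤ 2 * Real.exp (-x) := by
  set β := shift (covX P) βstar (r • b) with hβ
  set θ := shift (covX P) θstar ((r / α) • t) with hθ
  -- The displacement r/α of θ cancels the factor α of the residual, so both parameters contribute
  -- at scale r.
  have hclose : ∀ z : Vec p × ℝ, |esResid α β θ z.1 z.2 - esResid α βstar θstar z.1 z.2|
      ≤ r * (2 * |⟪b, standardize (covX P) z.1⟫| + |⟪t, standardize (covX P) z.1⟫|) := by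
    intro z
    refine (abs_esResid_sub_le α h0 h1 _ _ _ _ _ _).trans (le_of_eq ?_)
    rw [hβ, hθ, inner_shift_sub, inner_shift_sub, real_inner_smul_left, real_inner_smul_left,
      ← mul_assoc, mul_div_cancel₀ _ h0.ne', abs_mul, abs_mul, abs_of_pos hr]
    ring
  have hΦ := envelope_standardize_integrable hυ hC u b t hu hb ht
  have hw₀ := measurable_esResid α βstar θstar
  have hw := measurable_esResid α β θ
  have ha := measurable_inner_standardize (covX P) u
  have hb' := measurable_inner_standardize (covX P) b
  have ht' := measurable_inner_standardize (covX P) t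
  obtain ⟨hfi, hbias⟩ := integral_truncated_sub_le P _ _ hw₀ hw _ _ _ ha hb' ht' υ
    (envelopeConst υ) r σ (8 * α₃) γ hr.le (by positivity) hγ hclose hmom hΦ hσ
  obtain ⟨hei, he⟩ := integral_truncated_sq_mul_exp_le P _ _ hw₀ hw _ _ _ ha hb' ht' υ
    (envelopeConst υ) r σ (8 * α₃) γ hr.le (by positivity) hγ hclose hmom hΦ
  have hK : 0 < envelopeConst υ := by unfold envelopeConst; positivity
  have hV0 : 0 < V := lt_of_lt_of_le (by positivity) hV
  have hψ := measurable_huberScore_sq hγ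
  have hB := bernstein_mean P μ hn ξ hξ hind hlaw
    (fun z => huberScore γ (esResid α β θ z.1 z.2) ^ 2 * ⟪u, standardize (covX P) z.1⟫ ^ 2)
    ((hψ.comp hw).mul ((ha.comp measurable_fst).pow_const 2)) V (1 / (16 * υ ^ 2 * γ ^ 2)) x hV0
    (by positivity) hx hfi hei (he.trans hV)
  refine le_trans (measureReal_mono ?_) hB
  intro s hs
  simp only [Set.mem_ofPred_eq] at hs ⊢
  have e : x / (n * (1 / (16 * υ ^ 2 * γ ^ 2))) = 16 * υ ^ 2 * γ ^ 2 * (x / n) := by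
    field_simp
  rw [e]
  have tri := abs_sub_le (1 / (n : ℝ) * ∑ i, huberScore γ (esResid α β θ (ξ i s).1 (ξ i s).2) ^ 2
          * ⟪u, standardize (covX P) (ξ i s).1⟫ ^ 2)
    (∫ z, huberScore γ (esResid α β θ z.1 z.2) ^ 2 * ⟪u, standardize (covX P) z.1⟫ ^ 2 ∂P)
    (∫ z, esResid α βstar θstar z.1 z.2 ^ 2 * ⟪u, standardize (covX P) z.1⟫ ^ 2 ∂P)
  linarith

/-- The sample quadratic form is Lipschitz in the parameters when the covariates are bounded. -/
lemma quadratic_form_lipschitz {n : ℕ} (hn : 0 < n) {α γ : ℝ} (h0 : 0 < α) (h1 : α < 1)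
    (hγ : 0 < γ) (S : Matrix (Fin p) (Fin p) ℝ) (x : Fin n → Vec p) (y : Fin n → ℝ) (R d : ℝ)
    (hR0 : 0 ≤ R) (hd0 : 0 ≤ d) (hR : ∀ i, ‖standardize S (x i)‖ ≤ R) (β θ β' θ' b t : Vec p)
    (hβ : ∀ x, ⟪x, β - β'⟫ = ⟪b, standardize S x⟫)
    (hθ : ∀ x, α * ⟪x, θ - θ'⟫ = ⟪t, standardize S x⟫) (hb : ‖b‖ ≤ d) (ht : ‖t‖ ≤ d)
    (u : Vec p) (hu : ‖u‖ ≤ 1) :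
    |1 / (n : ℝ) * ∑ i, huberScore γ (esResid α β θ (x i) (y i)) ^ 2 * ⟪u, standardize S (x i)⟫ ^ 2
      - 1 / (n : ℝ) * ∑ i, huberScore γ (esResid α β' θ' (x i) (y i)) ^ 2
        * ⟪u, standardize S (x i)⟫ ^ 2| ≤ 6 * γ * d * R ^ 3 := by
  have hn' : (0 : ℝ) < n := by exact_mod_cast hn
  rw [← mul_sub, ← Finset.sum_sub_distrib, abs_mul, abs_of_nonneg (by positivity), one_div,
    inv_mul_le_iff₀ hn']
  refine (Finset.abs_sum_le_sum_abs _ _).trans ((Finset.sum_le_card_nsmul _ _ (6 * γ * d * R ^ 3)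
    fun i _ => ?_).trans_eq (by simp))
  have hin : ∀ (v : Vec p) (e : ℝ), 0 ≤ e → ‖v‖ ≤ e → |⟪v, standardize S (x i)⟫| ≤ e * R :=
    fun v e he hv => (abs_real_inner_le_norm _ _).trans
      (mul_le_mul hv (hR i) (norm_nonneg _) he)
  have hu2 : ⟪u, standardize S (x i)⟫ ^ 2 ≤ R ^ 2 := by
    rw [← sq_abs]
    have := hin u 1 zero_le_one hu
    rw [one_mul] at this
    gcongr
  rw [← sub_mul, abs_mul, abs_of_nonneg (sq_nonneg ⟪u, standardize S (x i)⟫)]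
  calc _ ≤ 2 * γ * (2 * (d * R) + d * R) * R ^ 2 := by
        refine mul_le_mul ((abs_huberScore_sq_sub_le' hγ _ _).trans ?_) hu2 (by positivity)
          (by positivity)
        gcongr
        refine (abs_esResid_sub_le α h0 h1 _ _ _ _ _ _).trans ?_
        rw [hβ, hθ]
        gcongr
        · exact hin b d hd0 hb
        · exact hin t d hd0 ht
    _ = _ := by ring

end Model

/-! ### Arithmetic of the rate -/

/-- Since 2n⁴ + 1 ≤ n⁵ for n ≥ 3, three grids cost n^{15p} against a tail 2n^{−16p}; the remaining
2n^{−p} is at most 2/n. -/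
lemma card_mul_exp_le (n p : ℕ) (hn : 3 ≤ n) (hp : 1 ≤ p) :
    (((2 * n ^ 4 + 1) ^ p : ℕ) : ℝ) ^ 3 * (2 * Real.exp (-(16 * (p * Real.log n)))) ≤ 2 / n := by
  have hn' : (3 : ℝ) ≤ n := by exact_mod_cast hn
  have hn0 : (0 : ℝ) < n := by linarith
  have h1 : (2 * (n : ℝ) ^ 4 + 1) ≤ (n : ℝ) ^ 5 := by
    have : (1 : ℝ) ≤ (n : ℝ) ^ 4 := one_le_pow₀ (by linarith)
    have e : (n : ℝ) ^ 5 = n * (n : ℝ) ^ 4 := by ring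
    rw [e]; nlinarith
  have h2 : Real.exp (-(16 * (p * Real.log n))) = ((n : ℝ) ^ (16 * p))⁻¹ := by
    rw [Real.exp_neg, ← Real.exp_log (show (0 : ℝ) < (n : ℝ) ^ (16 * p) by positivity),
      Real.log_pow]
    push_cast
    congr 2
    ring
  rw [h2]
  have h3 : (((2 * n ^ 4 + 1) ^ p : ℕ) : ℝ) ^ 3 ≤ (n : ℝ) ^ (15 * p) := by
    push_cast
    calc ((2 * (n : ℝ) ^ 4 + 1) ^ p) ^ 3 ≤ (((n : ℝ) ^ 5) ^ p) ^ 3 := by gcongr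
      _ = _ := by ring
  have h4 : (n : ℝ) ≤ (n : ℝ) ^ p := le_self_pow₀ (by linarith) (by omega)
  have h5 : (n : ℝ) ^ (16 * p) = (n : ℝ) ^ (15 * p) * (n : ℝ) ^ p := by
    rw [← pow_add]; congr 1; ring
  calc _ ≤ (n : ℝ) ^ (15 * p) * (2 * ((n : ℝ) ^ (16 * p))⁻¹) := by gcongr
    _ = 2 / (n : ℝ) ^ p := by rw [h5]; field_simp
    _ ≤ 2 / n := by gcongr

/-- The stochastic, bias and discretization errors add up to the rate. -/
lemma error_terms_le_rate (n p : ℕ) (hn : 3 ≤ n) (hp : 1 ≤ p) (hpn : p ≤ n)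
    (υ C₀ α₃ γ σ r K m : ℝ) (hC₀ : 0 < C₀) (hα₃ : 0 < α₃) (hγ : 0 < γ) (hσ : 0 < σ) (hr : 0 < r)
    (hK : 0 < K) (hm : m = max (Real.sqrt α₃) ((Real.sqrt p * r) ^ (3 / 2 : ℝ))) :
    2 * (2 * Real.sqrt (36 * γ * K * m ^ 2 * (16 * (p * Real.log n)) / n)
        + 16 * υ ^ 2 * γ ^ 2 * (16 * (p * Real.log n) / n)
        + K * (8 * α₃ / γ + 2 * r * σ + r ^ 2)
      + 6 * γ * (r * (Real.sqrt p / (n ^ 4 : ℕ))) * (C₀ * Real.sqrt p) ^ 3)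
    ≤ 2 * (48 * Real.sqrt K + 256 * υ ^ 2 + 8 * K + 6 * C₀ ^ 3) * rate n p α₃ γ σ r := by
  have hn3 : (3 : ℝ) ≤ n := by exact_mod_cast hn
  have hn0 : (0 : ℝ) < n := by linarith
  have hp1 : (1 : ℝ) ≤ p := by exact_mod_cast hp
  have hpn' : (p : ℝ) ≤ n := by exact_mod_cast hpn
  have hlog : 1 ≤ Real.log n := by
    rw [Real.le_log_iff_exp_le hn0]
    linarith [Real.exp_one_lt_d9]
  have hm0 : 0 ≤ m := by rw [hm]; exact (Real.sqrt_nonneg _).trans (le_max_left _ _)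
  set Λ := (p : ℝ) * Real.log n / n with hΛ
  have hΛ1 : 1 / n ≤ Λ := by
    rw [hΛ]; gcongr; nlinarith
  have hΛ0 : 0 < Λ := lt_of_lt_of_le (by positivity) hΛ1
  have e1 : Real.sqrt (36 * γ * K * m ^ 2 * (16 * (p * Real.log n)) / n)
      = 24 * Real.sqrt K * (m * Real.sqrt (γ * Λ)) := by
    have : 36 * γ * K * m ^ 2 * (16 * (p * Real.log n)) / n
        = 24 ^ 2 * K * (m ^ 2 * (γ * Λ)) := by rw [hΛ]; ring
    rw [this, Real.sqrt_mul (by positivity), Real.sqrt_mul (by positivity),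
      Real.sqrt_mul (by positivity), Real.sqrt_sq (by norm_num), Real.sqrt_sq hm0]
  have e2 : 16 * (p * Real.log n) / n = 16 * Λ := by rw [hΛ]; ring
  -- Discretization error: p ≤ n gives p²/n⁴ ≤ 1/n, and γr/n ≤ γ²/n + r² splits it between two terms
  -- of the rate.
  have e3 : 6 * γ * (r * (Real.sqrt p / (n ^ 4 : ℕ))) * (C₀ * Real.sqrt p) ^ 3
      ≤ 6 * C₀ ^ 3 * (γ ^ 2 * Λ + r ^ 2) := by
    have hs : Real.sqrt p ^ 2 = p := Real.sq_sqrt (by positivity)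
    have h1 : 6 * γ * (r * (Real.sqrt p / (n ^ 4 : ℕ))) * (C₀ * Real.sqrt p) ^ 3
        = 6 * C₀ ^ 3 * (γ * r * ((p : ℝ) ^ 2 / (n : ℝ) ^ 4)) := by
      have hs4 : Real.sqrt p ^ 4 = (p : ℝ) ^ 2 := by
        rw [show Real.sqrt p ^ 4 = (Real.sqrt p ^ 2) ^ 2 by ring, hs]
      rw [← hs4]; push_cast; ring
    have h2 : (p : ℝ) ^ 2 / (n : ℝ) ^ 4 ≤ 1 / n := by
      rw [div_le_div_iff₀ (by positivity) hn0]
      have : (p : ℝ) ^ 2 ≤ (n : ℝ) ^ 2 := by gcongr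
      have hn1 : (1 : ℝ) ≤ n := by linarith
      calc (p : ℝ) ^ 2 * n ≤ (n : ℝ) ^ 2 * n := by gcongr
        _ = (n : ℝ) ^ 3 := by ring
        _ ≤ (n : ℝ) ^ 4 := pow_le_pow_right₀ hn1 (by norm_num)
        _ = _ := by ring
    have h3 : γ * r * (1 / n) ≤ γ ^ 2 * (1 / n) + r ^ 2 := by
      have h4 : (1 : ℝ) / n ≤ 1 := by rw [div_le_one hn0]; linarith
      have h5 : (0 : ℝ) < 1 / n := by positivity
      have h6 : 0 < γ * r := by positivity
      nlinarith [sq_nonneg (γ - r), mul_nonneg h5.le (sq_nonneg (γ - r)),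
        mul_nonneg (sub_nonneg.2 h4) (sq_nonneg r), mul_nonneg h5.le (sq_nonneg γ),
        mul_nonneg h5.le (sq_nonneg r)]
    rw [h1]
    gcongr
    calc γ * r * ((p : ℝ) ^ 2 / (n : ℝ) ^ 4) ≤ γ * r * (1 / n) := by gcongr
      _ ≤ _ := h3
      _ ≤ _ := by gcongr
  rw [e1, e2, rate, ← hm, ← hΛ]
  have hA : 0 ≤ m * Real.sqrt (γ * Λ) := by positivity
  have hB : 0 ≤ γ ^ 2 * Λ := by positivity
  have hD : 0 ≤ α₃ / γ := by positivity
  have hE : 0 ≤ r * σ := by positivity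
  have hF : 0 ≤ r ^ 2 := by positivity
  have hk : 0 ≤ Real.sqrt K := Real.sqrt_nonneg _
  have hu : 0 ≤ υ ^ 2 := sq_nonneg _
  have hc : 0 ≤ C₀ ^ 3 := by positivity
  have e4 : 8 * α₃ / γ = 8 * (α₃ / γ) := by ring
  have e5 : (σ + r) * r = r * σ + r ^ 2 := by ring
  rw [e4, e5]
  set a := m * Real.sqrt (γ * Λ)
  set b := γ ^ 2 * Λ
  set d := α₃ / γ
  set e := r * σ
  set f := r ^ 2
  set k := Real.sqrt K
  set w := υ ^ 2
  set c := C₀ ^ 3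
  have key : 48 * k * a + 256 * w * b + K * (8 * d + 2 * e + f) + 6 * c * (b + f)
      ≤ (48 * k + 256 * w + 8 * K + 6 * c) * (a + b + d + (e + f)) := by
    have hsum : 0 ≤ a + b + d + (e + f) := by positivity
    have k1 : 48 * k * a ≤ 48 * k * (a + b + d + (e + f)) := by gcongr; linarith
    have k2 : 256 * w * b ≤ 256 * w * (a + b + d + (e + f)) := by gcongr; linarith
    have k3 : K * (8 * d + 2 * e + f) ≤ K * (8 * (a + b + d + (e + f))) := by gcongr; linarith
    have k4 : 6 * c * (b + f) ≤ 6 * c * (a + b + d + (e + f)) :=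
      mul_le_mul_of_nonneg_left (by linarith) (by positivity)
    linarith
  have e6 : 16 * υ ^ 2 * γ ^ 2 * (16 * Λ) = 256 * w * b := by ring
  rw [e6]
  have e7 : 2 * r * σ = 2 * e := by ring
  rw [e7]
  linarith

/-- Both α₃ and r³ ≤ (√p r)³ are at most m², whence 36 = 4 · (8 + 1). -/
lemma variance_proxy_le (p : ℕ) (hp : 1 ≤ p) (α₃ γ r K m : ℝ) (hα₃ : 0 < α₃) (hγ : 0 < γ)
    (hr : 0 < r) (hK : 0 < K)
    (hm : m = max (Real.sqrt α₃) ((Real.sqrt p * r) ^ (3 / 2 : ℝ))) :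
    4 * γ * K * (8 * α₃ + r ^ 3) ≤ 36 * γ * K * m ^ 2 := by
  have hp1 : (1 : ℝ) ≤ Real.sqrt p := by
    rw [Real.one_le_sqrt]; exact_mod_cast hp
  have h1 : α₃ ≤ m ^ 2 := by
    rw [← Real.sq_sqrt hα₃.le, hm]
    gcongr
    exact le_max_left _ _
  have h2 : r ^ 3 ≤ m ^ 2 := by
    calc r ^ 3 ≤ (Real.sqrt p * r) ^ 3 := by gcongr; exact le_mul_of_one_le_left hr.le hp1
      _ = ((Real.sqrt p * r) ^ (3 / 2 : ℝ)) ^ 2 := by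
        rw [← Real.rpow_natCast, ← Real.rpow_natCast, ← Real.rpow_mul (by positivity)]
        norm_num
      _ ≤ m ^ 2 := by rw [hm]; gcongr; exact le_max_right _ _
  have : 0 < 4 * γ * K := by positivity
  nlinarith

/-- One event on which the error bound holds at all parameters of the local set. -/
lemma exists_uniform_event {υ C₀ : ℝ} (hυ : 1 ≤ υ) (hC₀ : 0 < C₀) {n p : ℕ} (hn : 3 ≤ n)
    (hp : 1 ≤ p) (hpn : p ≤ n) (P : Measure (Vec p × ℝ)) [IsProbabilityMeasure P] {α : ℝ}
    (h0 : 0 < α) (h1 : α < 1) (βstar θstar : Vec p) (σ α₃ : ℝ) (hσ : 0 < σ) (hα₃ : 0 < α₃)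
    (hC : CondCovariate P υ)
    (hmom : ∀ᵐ x ∂P.fst,
      ∫⁻ y, ENNReal.ofReal (esResid α βstar θstar x y ^ 2) ∂(P.condKernel x)
        ≤ ENNReal.ofReal (σ ^ 2) ∧
      ∫⁻ y, ENNReal.ofReal (|esResid α βstar θstar x y| ^ 3) ∂(P.condKernel x)
        ≤ ENNReal.ofReal (8 * α₃))
    {S : Type*} [MeasurableSpace S] (μ : Measure S) [IsProbabilityMeasure μ]
    (X : Fin n → S → Vec p) (Y : Fin n → S → ℝ)
    (hX : ∀ i, Measurable (X i)) (hY : ∀ i, Measurable (Y i))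
    (hind : iIndepFun (fun i s => (X i s, Y i s)) μ)
    (hlaw : ∀ i, HasLaw (fun s => (X i s, Y i s)) P μ)
    (hbdd : ∀ᵐ s ∂μ, ∀ i, ‖standardize (covX P) (X i s)‖ ≤ C₀ * Real.sqrt p)
    (r₀ r₁ γ : ℝ) (hr₀ : 0 < r₀) (hr₁ : 0 < r₁) (hγ : 0 < γ) :
    ∃ A : Set S, MeasurableSet A ∧ 1 - 2 / (n : ℝ) ≤ μ.real A ∧ ∀ s ∈ A, ∀ β θ : Vec p,
      (β, θ) ∈ localSet P α βstar θstar r₀ r₁ →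
      covError P α βstar θstar γ (fun i => X i s) (fun i => Y i s) β θ
        ≤ 2 * (48 * Real.sqrt (envelopeConst υ) + 256 * υ ^ 2 + 8 * envelopeConst υ + 6 * C₀ ^ 3)
          * rate n p α₃ γ σ (r₀ + r₁) := by
  classical
  have hn0 : 0 < n := by omega
  have hn0' : (0 : ℝ) < n := by exact_mod_cast hn0
  have hp' : (1 : ℝ) ≤ p := by exact_mod_cast hp
  have hlog : 0 < Real.log n := Real.log_pos (by exact_mod_cast (by omega : 1 < n))
  have hK : 0 < envelopeConst υ := by unfold envelopeConst; positivity
  set K := envelopeConst υ with hKd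
  set r := r₀ + r₁ with hrd
  have hr : 0 < r := by positivity
  obtain ⟨m, hm⟩ : ∃ m, m = max (Real.sqrt α₃) ((Real.sqrt p * r) ^ (3 / 2 : ℝ)) := ⟨_, rfl⟩
  set x := 16 * (p * Real.log n) with hx
  have hx0 : 0 < x := by positivity
  set D := 2 * Real.sqrt (36 * γ * K * m ^ 2 * x / n) + 16 * υ ^ 2 * γ ^ 2 * (x / n)
    + K * (8 * α₃ / γ + 2 * r * σ + r ^ 2) with hDd
  have hrate := error_terms_le_rate n p hn hp hpn υ C₀ α₃ γ σ r K m hC₀ hα₃ hγ hσ hr hK hm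
  -- One grid serves for u, b and t; u only needs distance 1/4, while b and t need the fine mesh.
  obtain ⟨G, hG1, hGcard, hG⟩ := exists_grid_net p (n ^ 4) (by positivity)
  set δ := Real.sqrt p / ((n ^ 4 : ℕ) : ℝ) with hδ
  have hδ0 : 0 ≤ δ := by positivity
  have hδ4 : δ ≤ 1 / 4 := by
    have h3 : (3 : ℝ) ≤ n := by exact_mod_cast hn
    have hs : Real.sqrt p ≤ n := by
      rw [Real.sqrt_le_left hn0'.le]
      have : (p : ℝ) ≤ n := by exact_mod_cast hpn
      nlinarith
    rw [hδ, div_le_iff₀ (by positivity)]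
    push_cast
    have : (27 : ℝ) ≤ (n : ℝ) ^ 3 := by
      calc (27 : ℝ) = 3 ^ 3 := by norm_num
        _ ≤ _ := by gcongr
    have e : (n : ℝ) ^ 4 = n * (n : ℝ) ^ 3 := by ring
    rw [e]
    nlinarith
  let q : Vec p × Vec p × Vec p → S → ℝ := fun g s =>
    |1 / (n : ℝ) * ∑ i, huberScore γ (esResid α (shift (covX P) βstar (r • g.2.1))
          (shift (covX P) θstar ((r / α) • g.2.2)) (X i s) (Y i s)) ^ 2
        * ⟪g.1, standardize (covX P) (X i s)⟫ ^ 2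
      - ∫ z, esResid α βstar θstar z.1 z.2 ^ 2 * ⟪g.1, standardize (covX P) z.1⟫ ^ 2 ∂P|
  have hqm : ∀ g, Measurable (q g) := by
    intro g
    refine (Measurable.abs ?_)
    refine Measurable.sub_const (Measurable.const_mul (Finset.measurable_sum _ fun i _ => ?_) _) _
    refine Measurable.mul ?_ ?_
    · exact (measurable_huberScore_sq hγ).comp
        ((measurable_esResid _ _ _).comp ((hX i).prodMk (hY i)))
    · exact ((measurable_inner_standardize _ _).comp (hX i)).pow_const 2
  have htail : ∀ g ∈ G ×ˢ G ×ˢ G, μ.real {s | D ≤ q g s} ≤ 2 * Real.exp (-x) := by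
    intro g hg
    simp only [Finset.mem_product] at hg
    exact quadratic_form_tail hυ hC h0 h1 βstar θstar σ α₃ γ r (36 * γ * K * m ^ 2) x hσ hα₃ hγ hr
      hx0 hmom (variance_proxy_le p hp α₃ γ r K m hα₃ hγ hr hK hm) μ hn0
      (fun i s => (X i s, Y i s)) (fun i => (hX i).prodMk (hY i)) hind
      (fun i => (hlaw i).map_eq) g.1 g.2.1 g.2.2 (hG1 _ hg.1) (hG1 _ hg.2.1) (hG1 _ hg.2.2)
  set bad := ⋃ g ∈ G ×ˢ G ×ˢ G, {s | D ≤ q g s} with hbad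
  have hbadm : MeasurableSet bad :=
    Finset.measurableSet_biUnion _ fun g _ => measurableSet_le measurable_const (hqm g)
  have hbadμ : μ.real bad ≤ 2 / n := by
    refine (measureReal_biUnion_finset_le _ _).trans ?_
    refine (Finset.sum_le_card_nsmul _ _ _ htail).trans ?_
    rw [nsmul_eq_mul, Finset.card_product, Finset.card_product]
    refine le_trans ?_ (card_mul_exp_le n p hn hp)
    have hc : (G.card : ℝ) ≤ ((2 * n ^ 4 + 1) ^ p : ℕ) := by exact_mod_cast hGcard
    gcongr
    push_cast at hc ⊢
    calc (G.card : ℝ) * (G.card * G.card) = (G.card : ℝ) ^ 3 := by ring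
      _ ≤ _ := by gcongr
  set bdd := {s | ∀ i, ‖standardize (covX P) (X i s)‖ ≤ C₀ * Real.sqrt p} with hbd
  have hbddm : MeasurableSet bdd := by
    rw [hbd, Set.ofPred_forall]
    exact MeasurableSet.iInter fun i =>
      measurableSet_le (((measurable_standardize _).comp (hX i)).norm) measurable_const
  refine ⟨badᶜ ∩ bdd, hbadm.compl.inter hbddm, ?_, ?_⟩
  · have e : μ.real (badᶜ ∩ bdd) = μ.real badᶜ := by
      refine measureReal_congr ?_
      filter_upwards [hbdd] with s hs
      exact propext ⟨fun h => h.1, fun h => ⟨h, hs⟩⟩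
    rw [e, probReal_compl_eq_one_sub hbadm]
    linarith
  · rintro s ⟨hsbad, hsbdd⟩ β θ ⟨hβ, hθ⟩
    have hgood : ∀ g ∈ G ×ˢ G ×ˢ G, q g s < D := by
      intro g hg
      by_contra! h
      exact hsbad (Set.mem_iUnion₂.2 ⟨g, hg, h⟩)
    set R := Matrix.toEuclideanCLM (n := Fin p) (𝕜 := ℝ) (sqrtM (covX P)) with hR
    change ‖R (β - βstar)‖ ≤ r₀ at hβ
    change α * ‖R (θ - θstar)‖ ≤ r₁ at hθ
    -- Both r₀ and r₁ are at most r, so a single scale puts the standardized displacements of β and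
    -- of αθ in the unit ball.
    have hnb : ‖r⁻¹ • R (β - βstar)‖ ≤ 1 := by
      rw [norm_smul, norm_inv, Real.norm_eq_abs, abs_of_pos hr, inv_mul_le_iff₀ hr]
      linarith
    have hnt : ‖(α / r) • R (θ - θstar)‖ ≤ 1 := by
      rw [norm_smul, norm_div, Real.norm_eq_abs, Real.norm_eq_abs, abs_of_pos hr, abs_of_pos h0,
        div_mul_eq_mul_div, div_le_iff₀ hr]
      linarith
    obtain ⟨b, hbG, hb⟩ := hG _ hnb
    obtain ⟨t, htG, ht⟩ := hG _ hnt
    have hβin : ∀ x', ⟪x', β - shift (covX P) βstar (r • b)⟫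
        = ⟪r • (r⁻¹ • R (β - βstar) - b), standardize (covX P) x'⟫ := by
      intro x'
      have e : β - shift (covX P) βstar (r • b)
          = (β - βstar) - (shift (covX P) βstar (r • b) - βstar) := by abel
      rw [e, inner_sub_right, inner_shift_sub, inner_sub_eq_of_posDef hC.2.1, smul_sub,
        inner_sub_left, smul_smul, mul_inv_cancel₀ hr.ne', one_smul]
    have hθin : ∀ x', α * ⟪x', θ - shift (covX P) θstar ((r / α) • t)⟫
        = ⟪r • ((α / r) • R (θ - θstar) - t), standardize (covX P) x'⟫ := by
      intro x'
      have e : θ - shift (covX P) θstar ((r / α) • t)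
          = (θ - θstar) - (shift (covX P) θstar ((r / α) • t) - θstar) := by abel
      rw [e, inner_sub_right, inner_shift_sub, inner_sub_eq_of_posDef hC.2.1, smul_sub,
        inner_sub_left, smul_smul, mul_div_cancel₀ _ hr.ne', real_inner_smul_left,
        real_inner_smul_left, real_inner_smul_left, ← hR]
      field_simp
    have hscale : ∀ v : Vec p, ‖v‖ ≤ δ → ‖r • v‖ ≤ r * δ := by
      intro v hv
      rw [norm_smul, Real.norm_eq_abs, abs_of_pos hr]
      gcongr
    refine (covError_le_of_net P α γ βstar θstar
      (integrable_esResid_sq_mul hC.1 α βstar θstar σ (hmom.mono fun x hx => hx.1))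
      (fun i => X i s) (fun i => Y i s) β θ (D + 6 * γ * (r * δ) * (C₀ * Real.sqrt p) ^ 3)
      (by positivity) (G : Set (Vec p)) hG1 (fun v hv => ?_) fun u hu => ?_).trans hrate
    · obtain ⟨g, hg, hgv⟩ := hG v hv
      exact ⟨g, hg, hgv.trans hδ4⟩
    · have hlip := quadratic_form_lipschitz hn0 h0 h1 hγ (covX P) (fun i => X i s)
        (fun i => Y i s) (C₀ * Real.sqrt p) (r * δ) (by positivity) (by positivity) hsbdd β θ
        (shift (covX P) βstar (r • b)) (shift (covX P) θstar ((r / α) • t)) _ _ hβin hθin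
        (hscale _ hb) (hscale _ ht) u (hG1 u hu)
      have hq := hgood (u, b, t) (by simpa [Finset.mem_product] using ⟨hu, hbG, htG⟩)
      refine (abs_sub_le _ _ _).trans ((add_le_add hlip hq.le).trans_eq (by ring))

end ESReg

/-! ### Choice of the constants and conclusion -/

theorem theorem4p7 (υ₁ C₀ : ℝ) (hυ₁ : 1 ≤ υ₁) (hC₀ : 0 < C₀) :
    -- the two constants depend on `υ₁` and `C₀` only
    ∃ C : ℝ, 0 < C ∧ ∃ C' : ℝ, 0 < C' ∧
      ∀ (n p : ℕ), 1 ≤ p → C' * ((p : ℝ) + Real.log n) ≤ (n : ℝ) →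
      -- the joint law of `(X, Y)` and the true parameters
      ∀ (P : Measure (ESReg.Vec p × ℝ)) [IsProbabilityMeasure P]
        (α : ℝ), 0 < α → α < 1 →
      ∀ (βstar θstar : ESReg.Vec p) (fbar σbar flow l₀ α₃ : ℝ),
        0 < σbar → 0 < flow → 0 < l₀ → 0 < α₃ →
        ESReg.JointModel P α βstar θstar →
        ESReg.CondDistribution P βstar fbar σbar →
        ESReg.CondCovariate P υ₁ →
        ESReg.CondDensity P βstar flow l₀ →
        ESReg.ThirdMoment P βstar α₃ →
      -- an i.i.d. sample of size `n` from `P`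
      ∀ {S : Type*} [MeasurableSpace S] (μ : Measure S) [IsProbabilityMeasure μ]
        (X : Fin n → S → ESReg.Vec p) (Y : Fin n → S → ℝ),
        (∀ i, Measurable (X i)) → (∀ i, Measurable (Y i)) →
        iIndepFun (fun i s => (X i s, Y i s)) μ →
        (∀ i, HasLaw (fun s => (X i s, Y i s)) P μ) →
        (∀ᵐ s ∂μ, ∀ i, ‖ESReg.standardize (ESReg.covX P) (X i s)‖ ≤ C₀ * Real.sqrt p) →
      ∀ (r₀ r₁ γ : ℝ), 0 < r₀ → 0 < r₁ → 0 < γ →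
        ∃ A : Set S, MeasurableSet A ∧ 1 - 2 / (n : ℝ) ≤ μ.real A ∧
          ∀ s ∈ A,
            -- the bound, whatever values in the local set the two estimates take
            (∀ β θ : ESReg.Vec p, (β, θ) ∈ ESReg.localSet P α βstar θstar r₀ r₁ →
              ESReg.covError P α βstar θstar γ (fun i => X i s) (fun i => Y i s) β θ
                ≤ C * ESReg.rate n p α₃ γ σbar (r₀ + r₁)) ∧
            -- the bound for the estimators themselves, when they lie in the local set
            (∀ τ : ℝ, 0 < τ → ∀ βhat θhat : ESReg.Vec p,
              ESReg.IsQREstimator α (fun i => X i s) (fun i => Y i s) βhat →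
              ESReg.IsHuberESEstimator α τ (fun i => X i s) (fun i => Y i s) βhat θhat →
              (βhat, θhat) ∈ ESReg.localSet P α βstar θstar r₀ r₁ →
              ESReg.covError P α βstar θstar γ (fun i => X i s) (fun i => Y i s) βhat θhat
                ≤ C * ESReg.rate n p α₃ γ σbar (r₀ + r₁)) := by
  have hK : 0 < ESReg.envelopeConst υ₁ := by unfold ESReg.envelopeConst; positivity
  refine ⟨2 * (48 * Real.sqrt (ESReg.envelopeConst υ₁) + 256 * υ₁ ^ 2
    + 8 * ESReg.envelopeConst υ₁ + 6 * C₀ ^ 3), by positivity, 3, by norm_num, ?_⟩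
  intro n p hp hnp P _ α h0 h1 βstar θstar fbar σbar flow l₀ α₃ hσ _ _ hα₃ hJ hD hC _ hT S _ μ _
    X Y hX hY hind hlaw hbdd r₀ r₁ γ hr₀ hr₁ hγ
  have hp' : (1 : ℝ) ≤ p := by exact_mod_cast hp
  have hlog0 : 0 ≤ Real.log n := Real.log_natCast_nonneg n
  -- With C' = 3 and p ≥ 1 the sample-size condition yields n ≥ 3 and p ≤ n; n = 0 is excluded too,
  -- as `Real.log 0 = 0`.
  have hn3 : 3 ≤ n := by
    have : (3 : ℝ) ≤ n := by linarith
    exact_mod_cast this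
  have hpn : p ≤ n := by
    have : (p : ℝ) ≤ n := by linarith
    exact_mod_cast this
  obtain ⟨A, hA, hAμ, hAb⟩ := ESReg.exists_uniform_event hυ₁ hC₀ hn3 hp hpn P h0 h1 βstar θstar
    σbar α₃ hσ hα₃ hC
    (ESReg.condKernel_esResid_moments P α h0 h1 βstar θstar fbar σbar α₃ hα₃ hJ hD hT)
    μ X Y hX hY hind hlaw hbdd r₀ r₁ γ hr₀ hr₁ hγ
  -- The event is uniform over the local set and free of τ, so data-dependent points of that set are
  -- covered.
  exact ⟨A, hA, hAμ, fun s hs => ⟨hAb s hs, fun _ _ βhat θhat _ _ h => hAb s hs βhat θhat h⟩⟩
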